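/- Let $n\ge 2$. The associahedron $K_n$ is a convex polytope of dimension $n-2$ whose poset of nonempty faces is isomorphic to the poset of bracketings of a path with $n$ nodes (sets of pairwise nested or disjoint brackets, each consisting of at least two consecutive nodes but not all $n$; adding brackets makes a bracketing smaller). To truncate a proper nonempty face $F$ of a polytope $P$ means to cut $P$ by a hyperplane that strictly separates $F$ from all vertices of $P$ not in $F$, and to discard the side containing $F$. (1) For all integers $x,y,z\ge 0$ with $x+y+z=n-2$, the associahedron $K_n$ is obtained from the product of simplices $\Delta_x\times\Delta_y\times\Delta_z$ by iterated truncation. More precisely, regard $\Delta_x\times\Delta_y\times\Delta_z$ as the space of configurations of $n-2$ ordered free particles on a circle with three distinct fixed particles, with $x$, $y$ and $z$ free particles in the three closed arcs between fixed particles (neighbouring particles may coincide). For every $k\ge1$, choose the codimension $k$ faces in which $k+1$ adjacent particles, at most one of them fixed, collide. Then these faces can be truncated successively in an order of increasing dimension, and the result of doing so is always a $K_n$. (2) The number of different ways of obtaining $K_n$ from iterated truncations of simplicial products, that is, the number of combinatorial types of products $\Delta_x\times\Delta_y\times\Delta_z$ with $x,y,z\ge0$ from which a $K_n$ can be obtained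 by a finite sequence of truncations of faces, is $$p_3(n-2)+p_2(n-2)+1,$$ where $p_k(m)$ denotes the number of partitions of $m$ into exactly $k$ positive parts. -/

import Mathlib

/-! ### Convex polytopes, their faces, and truncation -/

section Polytopes

variable {E : Type*} [NormedAddCommGroup E] [NormedSpace ℝ E]

/-- A convex polytope: the convex hull of a nonempty finite set of points. -/
def IsPolytope (P : Set E) : Prop :=
  ∃ s : Set E, s.Finite ∧ s.Nonempty ∧ P = convexHull ℝ s

/-- A (nonempty) face of `P`: the set of points of `P` at which some linear functional attains its
maximum over `P`. The zero functional gives `P` itself. -/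
def IsPolytopeFace (P F : Set E) : Prop :=
  F.Nonempty ∧ IsExposed ℝ P F

/-- The poset of nonempty faces of `P` (including `P`), ordered by inclusion. -/
abbrev FacePoset (P : Set E) : Type _ :=
  {F : Set E // IsPolytopeFace P F}

/-- The dimension of a convex set: the dimension of its affine span. -/
noncomputable def convexDim (P : Set E) : ℕ :=
  Module.finrank ℝ (vectorSpan ℝ P)

/-- `Q` is obtained from the polytope `P` by truncating the proper face `F`: a hyperplane `f = c`
strictly separates `F` from the vertices of `P` that are not in `F`, and the side containing `F`
is cut off. -/
def IsTruncation (P F Q : Set E) : Prop :=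
  IsPolytopeFace P F ∧ F ≠ P ∧
    ∃ (f : E →L[ℝ] ℝ) (c : ℝ),
      (∀ x ∈ F, c < f x) ∧
      (∀ v ∈ Set.extremePoints ℝ P, v ∉ F → f v < c) ∧
      Q = {x | x ∈ P ∧ f x ≤ c}

/-- `Q` is obtained from `P` by finitely many successive truncations of faces. -/
def IsIteratedTruncation (P Q : Set E) : Prop :=
  Relation.ReflTransGen (fun A B : Set E => ∃ F, IsTruncation A F B) P Q

/-- `TruncatesAlong L P Q`: the polytope `Q` is obtained from `P` by truncating one after the other
the members `F` of the list `L`; when the turn of `F` comes, what is truncated is the part of `F`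
that is left in the current polytope. -/
inductive TruncatesAlong : List (Set E) → Set E → Set E → Prop
  | nil (P : Set E) : TruncatesAlong [] P P
  | cons {F : Set E} {L : List (Set E)} {P P' Q : Set E} :
      IsTruncation P (F ∩ P) P' → TruncatesAlong L P' Q → TruncatesAlong (F :: L) P Q

end Polytopes

/-! ### The associahedron -/

/-- A bracket on the path with nodes `0, …, n - 1`: a set of at least two consecutive nodes that is
not the whole path. -/
def IsBracket {n : ℕ} (B : Finset (Fin n)) : Prop :=
  (∃ i j : Fin n, i < j ∧ B = Finset.Icc i j) ∧ B ≠ Finset.univ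

/-- A bracketing of the path with `n` nodes: a set of brackets, any two of which are nested or
disjoint. -/
def Bracketing (n : ℕ) : Type :=
  {S : Finset (Finset (Fin n)) // (∀ B ∈ S, IsBracket B) ∧
    ∀ B ∈ S, ∀ C ∈ S, B ⊆ C ∨ C ⊆ B ∨ Disjoint B C}

/-- `a ≤ a'` if `a` is obtained from `a'` by adding brackets. -/
instance (n : ℕ) : PartialOrder (Bracketing n) where
  le a a' := a'.1 ⊆ a.1
  le_refl _ := Finset.Subset.refl _
  le_trans _ _ _ h h' := Finset.Subset.trans h' h
  le_antisymm _ _ h h' := Subtype.ext (Finset.Subset.antisymm h' h)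

/-- `Q` is an associahedron `K_n`: a convex polytope of dimension `n - 2` whose face poset is
isomorphic to the poset of bracketings of a path with `n` nodes. -/
def IsAssociahedron {E : Type*} [NormedAddCommGroup E] [NormedSpace ℝ E] (n : ℕ) (Q : Set E) :
    Prop :=
  IsPolytope Q ∧ convexDim Q + 2 = n ∧ Nonempty (FacePoset Q ≃o Bracketing n)

/-! ### Triple products of simplices as configurations of particles on a circle -/

/-- The particles on a circle with three fixed particles `⟨r, 0⟩`, `r = 0, 1, 2`, and `k r` free
particles `⟨r, 1⟩, …, ⟨r, k r⟩`, in this order, between the fixed particles `⟨r, 0⟩` and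
`⟨r + 1, 0⟩` (indices `r` are taken mod `3`). -/
abbrev Particle (k : Fin 3 → ℕ) : Type :=
  Σ r : Fin 3, Fin (k r + 1)

/-- The fixed particles. -/
def Particle.IsFixed {k : Fin 3 → ℕ} (q : Particle k) : Prop :=
  q.2 = 0

/-- The particle that comes next on the circle. -/
def Particle.next {k : Fin 3 → ℕ} (q : Particle k) : Particle k :=
  if h : q.2.val < k q.1 then ⟨q.1, ⟨q.2.val + 1, Nat.succ_lt_succ h⟩⟩ else ⟨q.1 + 1, 0⟩

/-- The space of gap vectors: `g r i` is the distance from the particle `⟨r, i⟩` to the next one. -/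
abbrev GapSpace (k : Fin 3 → ℕ) : Type :=
  ∀ r : Fin 3, Fin (k r + 1) → ℝ

/-- The product of simplices `Δ_{k 0} × Δ_{k 1} × Δ_{k 2}`. Its points are the configurations of
particles for which the three fixed particles cut the circle into three arcs of length `1`; a
configuration `0 ≤ x₁ ≤ … ≤ x_{k r} ≤ 1` of the free particles on the arc `r` is recorded by its
`k r + 1` consecutive distances, which are the barycentric coordinates of a point of `Δ_{k r}`. -/
def simplexProduct (k : Fin 3 → ℕ) : Set (GapSpace k) :=
  Set.univ.pi fun r => stdSimplex ℝ (Fin (k r + 1))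

/-- The configurations in which the `m + 1` adjacent particles `q, next q, …, next^m q` collide. -/
def collisionFace {k : Fin 3 → ℕ} (q : Particle k) (m : ℕ) : Set (GapSpace k) :=
  {g | g ∈ simplexProduct k ∧
    ∀ j < m, g (Particle.next^[j] q).1 (Particle.next^[j] q).2 = 0}

/-- The faces of the product of simplices to be truncated: those (of codimension `m ≥ 1`) in which
`m + 1` adjacent particles, at most one of which is fixed, collide. -/
def collisionFaces (k : Fin 3 → ℕ) : Set (Set (GapSpace k)) :=
  {F | ∃ (q : Particle k) (m : ℕ), 1 ≤ m ∧
    (∀ i ≤ m, ∀ j ≤ m, (Particle.next^[i] q).IsFixed → (Particle.next^[j] q).IsFixed → i = j) ∧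
    F = collisionFace q m}

/-- `Q` is obtained from the product of simplices by truncating all the faces in `collisionFaces k`,
each of them once, in an order of increasing dimension. -/
def IsCollisionTruncation (k : Fin 3 → ℕ) (Q : Set (GapSpace k)) : Prop :=
  ∃ L : List (Set (GapSpace k)), L.Nodup ∧ (∀ F, F ∈ L ↔ F ∈ collisionFaces k) ∧
    L.Pairwise (fun F G => convexDim F ≤ convexDim G) ∧
    TruncatesAlong L (simplexProduct k) Q

/-! ### Counting -/

/-- Two triple products of simplices are the same if they are combinatorially equivalent, that is,
have isomorphic face posets. -/
def simplexProductSetoid : Setoid (Fin 3 → ℕ) where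
  r k k' := Nonempty (FacePoset (simplexProduct k) ≃o FacePoset (simplexProduct k'))
  iseqv :=
    { refl := fun _ => ⟨OrderIso.refl _⟩
      symm := fun ⟨e⟩ => ⟨e.symm⟩
      trans := fun ⟨e⟩ ⟨e'⟩ => ⟨e.trans e'⟩ }

/-- The combinatorial types of triple products of simplices from which an associahedron `K_n` can be
obtained by iterated truncation. -/
def associahedronSources (n : ℕ) : Set (Quotient simplexProductSetoid) :=
  {T | ∃ k : Fin 3 → ℕ, Quotient.mk simplexProductSetoid k = T ∧
    ∃ Q, IsIteratedTruncation (simplexProduct k) Q ∧ IsAssociahedron n Q}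

/-- The number of partitions of `m` into exactly `k` (positive) parts. -/
def partitionsIntoParts (k m : ℕ) : ℕ :=
  Fintype.card {p : Nat.Partition m // Multiset.card p.parts = k}

/-! Record a configuration by its `n + 1` gaps. The faces of the product of simplices correspond,
with inclusion reversed, to the sets of gaps that contain no whole arc between fixed particles.
Truncating a face performs a stellar subdivision on this dual complex, whichever admissible
hyperplane is used (`FaceLabelling.image_truncationLabel`), so only the family of truncated sets
matters.

That family consists of the runs of consecutive gaps containing no whole arc, that is, with at most
one fixed particle among their ends. If two of its runs share an end, their union is again in the
family unless it contains a whole arc (`union_mem_collisionGaps`). Thus the family is a building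
set. Increasing dimension of faces means that larger sets of gaps come first, and
`stellar_nestedFamily` then describes every intermediate complex. The final one consists of the
families of runs that are pairwise nested or have no common end (`nestedFamily_collisionGaps`).

To reach bracketings, split the circle of `n + 1` particles into two arcs of at least two particles
each. As there are three fixed particles, exactly one side contains at most one of them, so runs
correspond to such splittings. Removing a root particle leaves a path with `n` nodes, and the side
away from the root is a bracket. The ends of two runs never cover the circle, which makes
compatibility of runs and of brackets agree (`compatible_gapBracket_iff`).

For the count, truncation preserves dimension, so `x + y + z = n - 2` is necessary, and by the first
part it is sufficient. The face poset determines the positive dimensions of the factors: two facets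
come from the same factor exactly when every vertex off one lies on the other, and a factor of
dimension `j ≥ 1` has `j + 1` facets. The types are therefore the partitions of `n - 2` into at most
three parts. -/

/-! ### Compact convex sets whose points are labelled by their tight constraints -/

section FaceLabellings

variable {E : Type*} [NormedAddCommGroup E] [NormedSpace ℝ E] {ι : Type*}

/-- A labelling of the points of a compact convex set `P` that behaves like the set of tight
constraints of a point of a polytope: the relative interiors of the faces are its fibres. -/
structure FaceLabelling (P : Set E) (act : E → Set ι) : Prop where
  convex : Convex ℝ P
  compact : IsCompact P
  act_combo : ∀ x ∈ P, ∀ y ∈ P, ∀ a b : ℝ, 0 < a → 0 < b → a + b = 1 →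
    act (a • x + b • y) = act x ∩ act y
  extend : ∀ x ∈ P, ∀ y ∈ P, act x ⊆ act y → ∃ ε : ℝ, 0 < ε ∧ x + ε • (x - y) ∈ P
  expose : ∀ x ∈ P, ∃ l : E →L[ℝ] ℝ, ∀ y ∈ P, l y ≤ l x ∧ (l y = l x ↔ act x ⊆ act y)

theorem IsPolytopeFace.subset {P F : Set E} (hF : IsPolytopeFace P F) : F ⊆ P :=
  hF.2.isExtreme.1

theorem IsPolytopeFace.isCompact {P F : Set E} (hP : IsCompact P) (hF : IsPolytopeFace P F) :
    IsCompact F :=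
  hF.2.isCompact hP

theorem IsPolytopeFace.convex {P F : Set E} (hP : Convex ℝ P) (hF : IsPolytopeFace P F) :
    Convex ℝ F :=
  hF.2.convex hP

/-- A face that is not contained in a given closed convex set has a vertex outside of it. -/
theorem IsPolytopeFace.exists_extremePoint_notMem {P F C : Set E} (hPc : IsCompact P)
    (hP : Convex ℝ P) (hF : IsPolytopeFace P F) (hC : Convex ℝ C) (hC' : IsClosed C)
    (h : ¬ F ⊆ C) : ∃ v ∈ P.extremePoints ℝ, v ∈ F ∧ v ∉ C := by
  by_contra! hcon
  apply h
  rw [← closure_convexHull_extremePoints (hF.isCompact hPc) (hF.convex hP)]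
  refine closure_minimal (convexHull_min (fun v hv => ?_) hC) hC'
  exact hcon v (hF.2.isExtreme.extremePoints_subset_extremePoints hv) hv.1

theorem isPolytopeFace_self {P : Set E} (hP : P.Nonempty) : IsPolytopeFace P P :=
  ⟨hP, fun _ => ⟨0, by simp⟩⟩

namespace FaceLabelling

variable {P : Set E} {act : E → Set ι}

theorem isPolytopeFace (h : FaceLabelling P act) {σ : Set ι} (hσ : σ ∈ act '' P) :
    IsPolytopeFace P {y | y ∈ P ∧ σ ⊆ act y} := by
  obtain ⟨x, hx, rfl⟩ := hσ
  refine ⟨⟨x, hx, subset_rfl⟩, fun _ => ?_⟩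
  obtain ⟨l, hl⟩ := h.expose x hx
  refine ⟨l, ?_⟩
  ext y
  constructor
  · rintro ⟨hy, hxy⟩
    refine ⟨hy, fun z hz => ?_⟩
    rw [((hl y hy).2).2 hxy]
    exact (hl z hz).1
  · rintro ⟨hy, hmax⟩
    exact ⟨hy, (hl y hy).2.1 (le_antisymm (hl y hy).1 (hmax x hx))⟩

/-- A point `x` of `F` with minimal label is generic in `F`: the midpoint with any other point of
`F` has the intersection of the two labels, so minimality puts `act x` inside every label on `F`.
Conversely, if `act x ⊆ act y`, the segment from `y` extends beyond the maximizer `x`, which forces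
the exposing functional to be maximal at `y` too. -/
theorem eq_of_isPolytopeFace [Finite ι] (h : FaceLabelling P act) {F : Set E}
    (hF : IsPolytopeFace P F) : ∃ σ ∈ act '' P, F = {y | y ∈ P ∧ σ ⊆ act y} := by
  obtain ⟨_, ⟨x, hx, rfl⟩, hmin⟩ :=
    (wellFounded_lt (α := Set ι)).has_min (act '' F) (hF.1.image _)
  have hxP := hF.subset hx
  refine ⟨act x, ⟨x, hxP, rfl⟩, ?_⟩
  ext y
  constructor
  · intro hy
    refine ⟨hF.subset hy, ?_⟩
    have hmid : (1 / 2 : ℝ) • x + (1 / 2 : ℝ) • y ∈ F :=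
      hF.convex h.convex hx hy (by norm_num) (by norm_num) (by norm_num)
    have hact := h.act_combo x hxP y (hF.subset hy) (1 / 2) (1 / 2) (by norm_num) (by norm_num)
      (by norm_num)
    have hnot := hmin _ ⟨_, hmid, rfl⟩
    rw [hact] at hnot
    by_contra hsub
    exact hnot ⟨Set.inter_subset_left, fun hle => hsub fun i hi => (hle hi).2⟩
  · rintro ⟨hy, hxy⟩
    obtain ⟨l, rfl⟩ := hF.2 hF.1
    obtain ⟨ε, hε, hmem⟩ := h.extend x hxP y hy hxy
    have h1 := hx.2 _ hmem
    simp only [map_add, map_smul, map_sub, smul_eq_mul] at h1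
    have h2 : l x ≤ l y := by
      by_contra! hlt
      nlinarith [mul_pos hε (sub_pos.2 hlt)]
    exact ⟨hy, fun z hz => (hx.2 z hz).trans h2⟩

/-- The face poset is dual to the poset of labels that occur. -/
noncomputable def facePosetIso [Finite ι] (h : FaceLabelling P act) :
    (act '' P : Set (Set ι))ᵒᵈ ≃o FacePoset P :=
  RelIso.ofSurjective
    (OrderEmbedding.ofMapLEIff
      (fun σ => (⟨_, h.isPolytopeFace (OrderDual.ofDual σ).2⟩ : FacePoset P)) (by
        rintro ⟨σ, x, hx, rfl⟩ ⟨τ, hτ⟩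
        constructor
        · intro hle
          exact (hle (⟨hx, subset_rfl⟩ : x ∈ {y | y ∈ P ∧ act x ⊆ act y})).2
        · intro hle y hy
          exact ⟨hy.1, Set.Subset.trans hle hy.2⟩))
    (by
      rintro ⟨F, hF⟩
      obtain ⟨σ, hσ, rfl⟩ := h.eq_of_isPolytopeFace hF
      exact ⟨OrderDual.toDual ⟨σ, hσ⟩, rfl⟩)

theorem relabel (h : FaceLabelling P act) {ι' : Type*} {j : ι → ι'} (hj : Function.Injective j) :
    FaceLabelling P fun x => j '' act x where
  convex := h.convex
  compact := h.compact
  act_combo x hx y hy a b ha hb hab := by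
    rw [h.act_combo x hx y hy a b ha hb hab, Set.image_inter hj]
  extend x hx y hy hxy := h.extend x hx y hy ((Set.image_subset_image_iff hj).1 hxy)
  expose x hx := by simpa only [Set.image_subset_image_iff hj] using h.expose x hx

/-- Distinct vertices have distinct labels: with equal labels, the segment from `w` to `v` could be
prolonged beyond `v`. -/
theorem finite_extremePoints [Finite ι] (h : FaceLabelling P act) :
    (P.extremePoints ℝ).Finite := by
  refine Set.Finite.of_finite_image (f := act) (Set.toFinite _) ?_
  intro v hv w hw hvw
  by_contra hne
  obtain ⟨ε, hε, hmem⟩ := h.extend v hv.1 w hw.1 hvw.le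
  have hseg : v ∈ openSegment ℝ w (v + ε • (v - w)) := by
    have hpos : 0 < 1 + ε := by linarith
    refine ⟨ε / (1 + ε), 1 / (1 + ε), by positivity, by positivity, by field_simp; ring, ?_⟩
    have : (1 + ε) • ((ε / (1 + ε)) • w + (1 / (1 + ε)) • (v + ε • (v - w))) = (1 + ε) • v := by
      rw [smul_add, smul_smul, smul_smul, mul_div_cancel₀ _ hpos.ne',
        mul_div_cancel₀ _ hpos.ne']
      module
    exact smul_right_injective E hpos.ne' this
  exact hne ((mem_extremePoints_iff_left.1 hv).2 w hw.1 _ hmem hseg).symm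

theorem isPolytope [Finite ι] (h : FaceLabelling P act) (hne : P.Nonempty) : IsPolytope P := by
  refine ⟨P.extremePoints ℝ, h.finite_extremePoints, h.compact.extremePoints_nonempty hne, ?_⟩
  rw [← (h.finite_extremePoints.isClosed_convexHull (𝕜 := ℝ)).closure_eq]
  exact (closure_convexHull_extremePoints h.compact h.convex).symm

end FaceLabelling

/-- A functional exposing `F` also separates it: its values at the finitely many vertices off `F`
are strictly below its maximum, so a level fits in between. -/
theorem exists_isTruncation {P F : Set E} (hfin : (P.extremePoints ℝ).Finite)
    (hF : IsPolytopeFace P F) (hne : F ≠ P) : ∃ Q, IsTruncation P F Q := by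
  obtain ⟨l, hl⟩ := hF.2 hF.1
  obtain ⟨x, hx⟩ := hF.1
  have hFx : ∀ y ∈ F, l y = l x := by
    intro y hy
    rw [hl] at hx hy
    exact le_antisymm (hx.2 y hy.1) (hy.2 x hx.1)
  have hlt : ∀ v ∈ P.extremePoints ℝ \ F, l v < l x := by
    intro v hv
    rw [hl] at hx
    refine lt_of_le_of_ne (hx.2 v hv.1.1) fun heq => hv.2 ?_
    rw [hl]
    exact ⟨hv.1.1, fun y hy => heq ▸ hx.2 y hy⟩
  obtain ⟨c, hc, hcx⟩ : ∃ c, (∀ v ∈ P.extremePoints ℝ \ F, l v < c) ∧ c < l x := by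
    have hfin' : (l '' (P.extremePoints ℝ \ F)).Finite := (hfin.subset Set.sdiff_subset).image _
    rcases (l '' (P.extremePoints ℝ \ F)).eq_empty_or_nonempty with h0 | h0
    · refine ⟨l x - 1, fun v hv => ?_, by linarith⟩
      have : l v ∈ l '' (P.extremePoints ℝ \ F) := ⟨v, hv, rfl⟩
      simp [h0] at this
    · obtain ⟨m, ⟨w, hw, rfl⟩, hm⟩ := hfin'.exists_maximal h0
      obtain ⟨c, hc1, hc2⟩ := exists_between (hlt w hw)
      refine ⟨c, fun v hv => lt_of_le_of_lt ?_ hc1, hc2⟩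
      by_contra! hcon
      exact absurd (hm ⟨v, hv, rfl⟩ hcon.le) (not_le.2 hcon)
  exact ⟨_, hF, hne, l, c, fun y hy => hFx y hy ▸ hcx, fun v hv hvF => hc v ⟨hv, hvF⟩, rfl⟩

/-! ### What a truncation preserves -/

namespace IsTruncation

variable {P F Q : Set E}

theorem subset (h : IsTruncation P F Q) : Q ⊆ P := by
  obtain ⟨-, -, f, c, -, -, rfl⟩ := h
  exact fun x hx => hx.1

theorem isCompact (hP : IsCompact P) (h : IsTruncation P F Q) : IsCompact Q := by
  obtain ⟨-, -, f, c, -, -, rfl⟩ := h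
  exact hP.inter_right (isClosed_le f.continuous continuous_const)

theorem convex (hP : Convex ℝ P) (h : IsTruncation P F Q) : Convex ℝ Q := by
  obtain ⟨-, -, f, c, -, -, rfl⟩ := h
  exact hP.inter (convex_halfSpace_le f.isLinear c)

/-- Since `F ≠ P`, some vertex `v` lies off `F`, hence strictly on the side that is kept. Near `v`
nothing is cut off, so a short multiple of every direction `y - v` survives. -/
theorem vectorSpan_eq (hPc : IsCompact P) (hP : Convex ℝ P) (h : IsTruncation P F Q) :
    vectorSpan ℝ Q = vectorSpan ℝ P := by
  refine le_antisymm (vectorSpan_mono ℝ h.subset) ?_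
  obtain ⟨hF, hne, f, c, -, hv, rfl⟩ := h
  obtain ⟨v, hvP, -, hvF⟩ :=
    (isPolytopeFace_self (hF.1.mono hF.subset)).exists_extremePoint_notMem hPc hP
    (hF.convex hP) (hF.isCompact hPc).isClosed (fun hsub => hne (hF.subset.antisymm hsub))
  have hfv := hv v hvP hvF
  have hvQ : v ∈ {x | x ∈ P ∧ f x ≤ c} := ⟨hvP.1, hfv.le⟩
  rw [vectorSpan_eq_span_vsub_set_right ℝ hvP.1, Submodule.span_le]
  rintro _ ⟨y, hy, rfl⟩
  -- The summand `1` in the denominators below only prevents division by zero.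
  obtain ⟨t, ht0, ht1, htc⟩ : ∃ t : ℝ, 0 < t ∧ t ≤ 1 ∧ f v + t * (f y - f v) ≤ c := by
    have hd : 0 < |f y - f v| + 1 := by positivity
    refine ⟨min 1 ((c - f v) / (|f y - f v| + 1)), lt_min one_pos (div_pos (by linarith) hd),
      min_le_left _ _, ?_⟩
    have h1 : min 1 ((c - f v) / (|f y - f v| + 1)) ≤ (c - f v) / (|f y - f v| + 1) :=
      min_le_right _ _
    have h0 : 0 < min 1 ((c - f v) / (|f y - f v| + 1)) :=
      lt_min one_pos (div_pos (by linarith) hd)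
    rw [le_div_iff₀ hd] at h1
    nlinarith [le_abs_self (f y - f v), mul_le_mul_of_nonneg_left (le_abs_self (f y - f v)) h0.le]
  have hmem : v + t • (y - v) ∈ {x | x ∈ P ∧ f x ≤ c} := by
    refine ⟨hP.add_smul_sub_mem hvP.1 hy ⟨ht0.le, ht1⟩, ?_⟩
    simpa using htc
  have := Submodule.smul_mem _ t⁻¹ (vsub_mem_vectorSpan ℝ hmem hvQ)
  simpa [smul_smul, inv_mul_cancel₀ ht0.ne'] using this

end IsTruncation

/-- The labelling of a truncation: the new label `a` marks the points on the cutting hyperplane. -/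
def truncationLabel (act : E → Set ι) (a : ι) (f : E →L[ℝ] ℝ) (c : ℝ) (x : E) : Set ι :=
  act x ∪ {i | i = a ∧ f x = c}

theorem truncationLabel_of_ne {act : E → Set ι} {a : ι} {f : E →L[ℝ] ℝ} {c : ℝ} {x : E}
    (h : f x ≠ c) : truncationLabel act a f c x = act x := by
  simp [truncationLabel, h]

theorem truncationLabel_of_eq {act : E → Set ι} {a : ι} {f : E →L[ℝ] ℝ} {c : ℝ} {x : E}
    (h : f x = c) : truncationLabel act a f c x = insert a (act x) := by
  ext i
  simp [truncationLabel, h]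

/-! ### The face structure of a truncation -/

namespace FaceLabelling

variable {P : Set E} {act : E → Set ι}

/-- The label `a` must be new, so that inclusions between labels of the cut polytope restrict to
inclusions between old labels. Prolonged segments stay in the half-space after shortening, or
because both points lie on the hyperplane. -/
theorem halfSpace (h : FaceLabelling P act) {a : ι} (ha : ∀ x ∈ P, a ∉ act x)
    (f : E →L[ℝ] ℝ) (c : ℝ) :
    FaceLabelling {x | x ∈ P ∧ f x ≤ c} (truncationLabel act a f c) := by
  refine ⟨h.convex.inter (convex_halfSpace_le f.isLinear c),
    h.compact.inter_right (isClosed_le f.continuous continuous_const), ?_, ?_, ?_⟩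
  · rintro x ⟨hx, hfx⟩ y ⟨hy, hfy⟩ s t hs ht hst
    have hf : f (s • x + t • y) = c ↔ f x = c ∧ f y = c := by
      simp only [map_add, map_smul, smul_eq_mul]
      constructor
      · intro heq
        have h1 : s * (c - f x) + t * (c - f y) = 0 := by
          have : (s + t) * c = c := by rw [hst, one_mul]
          linarith
        have h2 := mul_nonneg hs.le (sub_nonneg.2 hfx)
        have h3 := mul_nonneg ht.le (sub_nonneg.2 hfy)
        have h4 : s * (c - f x) = 0 := by linarith
        have h5 : t * (c - f y) = 0 := by linarith
        rcases mul_eq_zero.1 h4 with h4 | h4 <;> rcases mul_eq_zero.1 h5 with h5 | h5 <;>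
          constructor <;> linarith
      · rintro ⟨h1, h2⟩
        rw [h1, h2, ← add_mul, hst, one_mul]
    ext i
    have h1 := ha x hx
    have h2 := ha y hy
    simp only [truncationLabel, h.act_combo x hx y hy s t hs ht hst, hf, Set.mem_union,
      Set.mem_inter_iff, Set.mem_ofPred_eq]
    constructor
    · tauto
    · rintro ⟨h3 | h3, h4 | h4⟩
      · exact Or.inl ⟨h3, h4⟩
      · exact absurd (h4.1 ▸ h3) h1
      · exact absurd (h3.1 ▸ h4) h2
      · exact Or.inr ⟨h3.1, h3.2, h4.2⟩
  · rintro x ⟨hx, hfx⟩ y ⟨hy, hfy⟩ hxy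
    have hact : act x ⊆ act y := by
      intro i hi
      rcases hxy (Or.inl hi) with h1 | h1
      · exact h1
      · exact absurd (h1.1 ▸ hi) (ha x hx)
    obtain ⟨ε, hε, hmem⟩ := h.extend x hx y hy hact
    rcases hfx.lt_or_eq with hlt | heq
    · have hd : 0 < |f x - f y| + 1 := by positivity
      have hm0 : 0 < min ε ((c - f x) / (|f x - f y| + 1)) :=
        lt_min hε (div_pos (by linarith) hd)
      have hm1 := min_le_left ε ((c - f x) / (|f x - f y| + 1))
      have hm2 := min_le_right ε ((c - f x) / (|f x - f y| + 1))
      set δ := min ε ((c - f x) / (|f x - f y| + 1))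
      refine ⟨δ, hm0, ?_, ?_⟩
      · have := h.convex.add_smul_sub_mem hx hmem (t := δ / ε)
          ⟨by positivity, (div_le_one hε).2 hm1⟩
        rwa [add_sub_cancel_left, smul_smul, div_mul_cancel₀ _ hε.ne'] at this
      · simp only [map_add, map_smul, map_sub, smul_eq_mul]
        rw [le_div_iff₀ hd] at hm2
        nlinarith [mul_le_mul_of_nonneg_left (le_abs_self (f x - f y)) hm0.le]
    · have hfy' : f y = c := by
        rcases hxy (Or.inr ⟨rfl, heq⟩) with h1 | h1
        · exact absurd h1 (ha y hy)
        · exact h1.2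
      exact ⟨ε, hε, hmem, by simp [heq, hfy']⟩
  · rintro x ⟨hx, hfx⟩
    obtain ⟨l, hl⟩ := h.expose x hx
    have key : ∀ y ∈ P, act x ⊆ truncationLabel act a f c y ↔ act x ⊆ act y := by
      intro y hy
      constructor
      · intro hxy i hi
        rcases hxy hi with h1 | h1
        · exact h1
        · exact absurd (h1.1 ▸ hi) (ha x hx)
      · exact fun hxy i hi => Or.inl (hxy hi)
    rcases hfx.lt_or_eq with hlt | heq
    · refine ⟨l, fun y hy => ⟨(hl y hy.1).1, ?_⟩⟩
      rw [truncationLabel_of_ne hlt.ne, key y hy.1]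
      exact (hl y hy.1).2
    -- On the hyperplane both `l` and `f` are maximal at `x`, so their sum is maximal exactly where
    -- both are.
    · refine ⟨l + f, fun y hy => ⟨?_, ?_⟩⟩
      · have := (hl y hy.1).1
        have := hy.2
        simp only [add_apply]
        linarith
      · rw [truncationLabel_of_eq heq, Set.insert_subset_iff, key y hy.1, ← (hl y hy.1).2]
        have h1 := (hl y hy.1).1
        have h2 := hy.2
        have h3 : a ∈ truncationLabel act a f c y ↔ f y = c := by
          simp [truncationLabel, ha y hy.1]
        rw [h3]
        simp only [add_apply]
        constructor
        · intro h4
          constructor <;> linarith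
        · rintro ⟨h4, h5⟩
          linarith

/-- Near a point whose label contains that of `x`, there are points with the label of `x`. -/
theorem exists_act_eq_lt (h : FaceLabelling P act) {x v : E} (hx : x ∈ P) (hv : v ∈ P)
    (hxv : act x ⊆ act v) (f : E →L[ℝ] ℝ) {c : ℝ} (hfv : f v < c) :
    ∃ y ∈ P, act y = act x ∧ f y < c := by
  have hd : 0 < |f x - f v| + 1 := by positivity
  have hm0 : 0 < min (1 / 2) ((c - f v) / (|f x - f v| + 1)) :=
    lt_min (by norm_num) (div_pos (by linarith) hd)
  have hm1 := min_le_left (1 / 2) ((c - f v) / (|f x - f v| + 1))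
  have hm2 := min_le_right (1 / 2) ((c - f v) / (|f x - f v| + 1))
  set δ := min (1 / 2) ((c - f v) / (|f x - f v| + 1))
  have h1 : 0 < 1 - δ := by linarith
  refine ⟨(1 - δ) • v + δ • x, h.convex hv hx h1.le hm0.le (by ring), ?_, ?_⟩
  · rw [h.act_combo v hv x hx _ _ h1 hm0 (by ring)]
    exact Set.inter_eq_right.2 hxv
  · simp only [map_add, map_smul, smul_eq_mul]
    rw [le_div_iff₀ hd] at hm2
    nlinarith [mul_le_mul_of_nonneg_left (le_abs_self (f x - f v)) hm0.le]

theorem exists_act_eq_gt (h : FaceLabelling P act) {x v : E} (hx : x ∈ P) (hv : v ∈ P)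
    (hxv : act x ⊆ act v) (f : E →L[ℝ] ℝ) {c : ℝ} (hfv : c < f v) :
    ∃ y ∈ P, act y = act x ∧ c < f y := by
  obtain ⟨y, hy, hyx, hlt⟩ := h.exists_act_eq_lt hx hv hxv (-f) (c := -c) (by simpa using hfv)
  exact ⟨y, hy, hyx, by simpa using hlt⟩

/-- Truncating a face performs a stellar subdivision on the labels. -/
theorem image_truncationLabel [Finite ι] (h : FaceLabelling P act) {a : ι} {σ : Set ι}
    {f : E →L[ℝ] ℝ} {c : ℝ}
    (hσ : σ ∈ act '' P) (hF : ∀ x ∈ P, σ ⊆ act x → c < f x)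
    (hV : ∀ v ∈ P.extremePoints ℝ, ¬ σ ⊆ act v → f v < c) :
    truncationLabel act a f c '' {x | x ∈ P ∧ f x ≤ c} =
      {τ | τ ∈ act '' P ∧ ¬ σ ⊆ τ} ∪
      {τ | ∃ τ' ∈ act '' P, ¬ σ ⊆ τ' ∧ (∃ ρ ∈ act '' P, τ' ∪ σ ⊆ ρ) ∧ τ = insert a τ'} := by
  have hface := h.isPolytopeFace hσ
  have vert : ∀ x ∈ P, ¬ σ ⊆ act x → ∃ v ∈ P, act x ⊆ act v ∧ f v < c := by
    intro x hx hσx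
    obtain ⟨v, hv, hv1, hv2⟩ := (h.isPolytopeFace ⟨x, hx, rfl⟩).exists_extremePoint_notMem
      h.compact h.convex (hface.convex h.convex) (hface.isCompact h.compact).isClosed
      (fun hsub => hσx (hsub ⟨hx, subset_rfl⟩).2)
    exact ⟨v, hv.1, hv1.2, hV v hv fun hsub => hv2 ⟨hv.1, hsub⟩⟩
  ext τ
  constructor
  · rintro ⟨x, ⟨hx, hfx⟩, rfl⟩
    have hσx : ¬ σ ⊆ act x := fun hsub => absurd (hF x hx hsub) (not_lt.2 hfx)
    rcases hfx.lt_or_eq with hlt | heq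
    · rw [truncationLabel_of_ne hlt.ne]
      exact Or.inl ⟨⟨x, hx, rfl⟩, hσx⟩
    · rw [truncationLabel_of_eq heq]
      refine Or.inr ⟨_, ⟨x, hx, rfl⟩, hσx, ?_, rfl⟩
      -- If the face of `x` missed the truncated face, all its vertices would lie strictly below the
      -- hyperplane. But the segment from a vertex below through `x` leaves `x` upwards inside that
      -- face.
      by_contra! hcon
      have hnot : ∀ y ∈ P, act x ⊆ act y → ¬ σ ⊆ act y :=
        fun y hy h1 h2 => hcon _ ⟨y, hy, rfl⟩ (Set.union_subset h1 h2)
      obtain ⟨v, hv, hxv, hfv⟩ := vert x hx hσx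
      obtain ⟨ε, hε, hmem⟩ := h.extend x hx v hv hxv
      have hpos : 0 < 1 + ε := by linarith
      have hact : act x ⊆ act (x + ε • (x - v)) := by
        have h1 := h.act_combo v hv _ hmem (ε / (1 + ε)) (1 / (1 + ε)) (by positivity)
          (by positivity) (by field_simp; ring)
        have h2 : (ε / (1 + ε)) • v + (1 / (1 + ε)) • (x + ε • (x - v)) = x := by
          have : (1 + ε) • ((ε / (1 + ε)) • v + (1 / (1 + ε)) • (x + ε • (x - v))) =
              (1 + ε) • x := by
            rw [smul_add, smul_smul, smul_smul, mul_div_cancel₀ _ hpos.ne',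
              mul_div_cancel₀ _ hpos.ne']
            module
          exact smul_right_injective E hpos.ne' this
        rw [h2] at h1
        rw [h1]
        exact Set.inter_subset_right
      have hsub : ¬ {y | y ∈ P ∧ act x ⊆ act y} ⊆ {y | f y ≤ c} := by
        intro hsub
        have := hsub ⟨hmem, hact⟩
        simp only [Set.mem_ofPred_eq, map_add, map_smul, map_sub, smul_eq_mul, heq] at this
        nlinarith [mul_pos hε (sub_pos.2 hfv)]
      obtain ⟨w, hw, hw1, hw2⟩ :=
        (h.isPolytopeFace ⟨x, hx, rfl⟩).exists_extremePoint_notMem h.compact h.convex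
        (convex_halfSpace_le f.isLinear c) (isClosed_le f.continuous continuous_const) hsub
      exact hw2 (hV w hw (hnot w hw.1 hw1.2)).le
  · rintro (⟨⟨x, hx, rfl⟩, hσx⟩ | ⟨_, ⟨x, hx, rfl⟩, hσx, ⟨_, ⟨z, hz, rfl⟩, hρ⟩, rfl⟩)
    · obtain ⟨v, hv, hxv, hfv⟩ := vert x hx hσx
      obtain ⟨y, hy, hyx, hfy⟩ := h.exists_act_eq_lt hx hv hxv f hfv
      exact ⟨y, ⟨hy, hfy.le⟩, by rw [truncationLabel_of_ne hfy.ne, hyx]⟩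
    · obtain ⟨v, hv, hxv, hfv⟩ := vert x hx hσx
      obtain ⟨y, hy, hyx, hfy⟩ := h.exists_act_eq_lt hx hv hxv f hfv
      -- The face of `x` has generic points `y` below and `w` above the hyperplane; the segment
      -- between them crosses it at a point with the same old label.
      obtain ⟨hxz, hσz⟩ := Set.union_subset_iff.1 hρ
      obtain ⟨w, hw, hwx, hfw⟩ := h.exists_act_eq_gt hx hz hxz f (hF z hz hσz)
      have hd : 0 < f w - f y := by linarith
      have ht0 : 0 < (c - f y) / (f w - f y) := div_pos (by linarith) hd
      have hs0 : 0 < (f w - c) / (f w - f y) := div_pos (by linarith) hd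
      have hst : (f w - c) / (f w - f y) + (c - f y) / (f w - f y) = 1 := by
        field_simp
        ring
      have hfm : f (((f w - c) / (f w - f y)) • y + ((c - f y) / (f w - f y)) • w) = c := by
        simp only [map_add, map_smul, smul_eq_mul]
        field_simp
        ring
      refine ⟨_, ⟨h.convex hy hw hs0.le ht0.le hst, hfm.le⟩, ?_⟩
      rw [truncationLabel_of_eq hfm, h.act_combo y hy w hw _ _ hs0 ht0 hst, hyx, hwx,
        Set.inter_self]

end FaceLabelling

end FaceLabellings

/-! ### Partially truncated nested set complexes -/

section NestedFamilies

variable {κ : Type*}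

/-- The union of the elements and sets that occur as labels in `T`. -/
def labelSupport (T : Set (κ ⊕ Set κ)) : Set κ :=
  {e | Sum.inl e ∈ T ∨ ∃ A, Sum.inr A ∈ T ∧ e ∈ A}

/-- The part of `labelSupport T` that comes from single elements and proper subsets of `B`. -/
def labelSupportBelow (T : Set (κ ⊕ Set κ)) (B : Set κ) : Set κ :=
  {e | Sum.inl e ∈ T ∨ ∃ A, Sum.inr A ∈ T ∧ A ⊂ B ∧ e ∈ A}

/-- The label sets of the polytope obtained from one with the label sets `Δ` by truncating the faces
given by the members of `𝓛`. -/
def nestedFamily (Δ 𝓛 : Set (Set κ)) : Set (Set (κ ⊕ Set κ)) :=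
  {T | (∀ A, Sum.inr A ∈ T → A ∈ 𝓛) ∧ labelSupport T ∈ Δ ∧ ∀ B ∈ 𝓛, ¬ B ⊆ labelSupportBelow T B}

variable {Δ 𝓛 : Set (Set κ)}

theorem labelSupport_mono {T T' : Set (κ ⊕ Set κ)} (h : T ⊆ T') :
    labelSupport T ⊆ labelSupport T' := by
  rintro e (he | ⟨A, hA, he⟩)
  exacts [Or.inl (h he), Or.inr ⟨A, h hA, he⟩]

theorem labelSupportBelow_mono {T T' : Set (κ ⊕ Set κ)} (h : T ⊆ T') (B : Set κ) :
    labelSupportBelow T B ⊆ labelSupportBelow T' B := by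
  rintro e (he | ⟨A, hA, he⟩)
  exacts [Or.inl (h he), Or.inr ⟨A, h hA, he⟩]

theorem nestedFamily_of_subset (hΔ : IsLowerSet Δ) {T T' : Set (κ ⊕ Set κ)}
    (hT : T' ∈ nestedFamily Δ 𝓛) (h : T ⊆ T') : T ∈ nestedFamily Δ 𝓛 :=
  ⟨fun A hA => hT.1 A (h hA), hΔ (labelSupport_mono h) hT.2.1,
    fun B hB hsub => hT.2.2 B hB (hsub.trans (labelSupportBelow_mono h B))⟩

theorem labelSupport_image_inl (A : Set κ) : labelSupport (Sum.inl '' A) = A := by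
  ext e
  simp [labelSupport]

theorem labelSupportBelow_image_inl (A B : Set κ) :
    labelSupportBelow (Sum.inl '' A) B = A := by
  ext e
  simp [labelSupportBelow]

theorem image_inl_mem_nestedFamily {A : Set κ} (hA : A ∈ Δ) (hmin : ∀ B ∈ 𝓛, ¬ B ⊆ A) :
    Sum.inl '' A ∈ nestedFamily Δ 𝓛 := by
  refine ⟨by simp, by rwa [labelSupport_image_inl], fun B hB => ?_⟩
  rw [labelSupportBelow_image_inl]
  exact hmin B hB

theorem nestedFamily_empty : nestedFamily Δ ∅ = (fun Z => Sum.inl '' Z) '' Δ := by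
  ext T
  constructor
  · rintro ⟨h1, h2, -⟩
    refine ⟨_, h2, ?_⟩
    ext (e | A)
    · simp only [labelSupport, Set.mem_image, Set.mem_ofPred_eq, Sum.inl.injEq, exists_eq_right]
      exact ⟨fun h => h.resolve_right fun ⟨A, hA, _⟩ => h1 A hA, Or.inl⟩
    · simpa using h1 A
  · rintro ⟨Z, hZ, rfl⟩
    exact image_inl_mem_nestedFamily hZ (by simp)

/-- Stellar subdivision of a face given by a set `A` adds `A` to the nested family, provided that
no subset and all unions with `A` have been treated before. -/
theorem stellar_nestedFamily (hΔ : IsLowerSet Δ) {A : Set κ} (hmin : ∀ B ∈ 𝓛, ¬ B ⊆ A)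
    (hup : ∀ B ∈ 𝓛, (A ∩ B).Nonempty → A ∪ B ∈ Δ → A ∪ B ∈ 𝓛) :
    {τ | τ ∈ nestedFamily Δ 𝓛 ∧ ¬ Sum.inl '' A ⊆ τ} ∪
      {τ | ∃ τ' ∈ nestedFamily Δ 𝓛, ¬ Sum.inl '' A ⊆ τ' ∧
        (∃ ρ ∈ nestedFamily Δ 𝓛, τ' ∪ Sum.inl '' A ⊆ ρ) ∧ τ = insert (Sum.inr A) τ'} =
      nestedFamily Δ (insert A 𝓛) := by
  have hA : A ∉ 𝓛 := fun h => hmin A h subset_rfl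
  -- No treated set lies strictly inside `A`, so only single elements can contribute below `A`.
  have hbelow : ∀ T : Set (κ ⊕ Set κ), (∀ B, Sum.inr B ∈ T → B ∈ insert A 𝓛) →
      labelSupportBelow T A = {e | Sum.inl e ∈ T} := by
    intro T hT
    ext e
    refine ⟨fun h => h.resolve_right ?_, Or.inl⟩
    rintro ⟨B, hB, hBA, -⟩
    rcases hT B hB with rfl | hB
    · exact hBA.ne rfl
    · exact hmin B hB hBA.subset
  ext T
  constructor
  · rintro (⟨⟨h1, h2, h3⟩, hAT⟩ | ⟨τ, hτ, hAT, ⟨ρ, hρ, hsub⟩, rfl⟩)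
    · refine ⟨fun B hB => Or.inr (h1 B hB), h2, ?_⟩
      rintro B (rfl | hB)
      · rw [hbelow T fun B hB => Or.inr (h1 B hB)]
        exact fun hsub => hAT (by rintro _ ⟨e, he, rfl⟩; exact hsub he)
      · exact h3 B hB
    · have hu := nestedFamily_of_subset hΔ hρ hsub
      have hins : ∀ B, Sum.inr B ∈ insert (Sum.inr A) τ → B ∈ insert A 𝓛 := by
        rintro B (hB | hB)
        · exact Or.inl (Sum.inr_injective hB)
        · exact Or.inr (hτ.1 B hB)
      refine ⟨hins, hΔ ?_ hu.2.1, ?_⟩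
      · rintro e (he | ⟨B, hB | hB, he⟩)
        · exact Or.inl (Or.inl (by simpa using he))
        · obtain rfl := Sum.inr_injective hB
          exact Or.inl (Or.inr ⟨e, he, rfl⟩)
        · exact Or.inr ⟨B, Or.inl hB, he⟩
      · rintro B (rfl | hB) hBT
        · rw [hbelow _ hins] at hBT
          refine hAT ?_
          rintro _ ⟨e, he, rfl⟩
          simpa using hBT he
        · refine hu.2.2 B hB fun e he => ?_
          rcases hBT he with h | ⟨C, hC | hC, hCB, heC⟩
          · exact Or.inl (Or.inl (by simpa using h))
          · obtain rfl := Sum.inr_injective hC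
            exact Or.inl (Or.inr ⟨e, heC, rfl⟩)
          · exact Or.inr ⟨C, Or.inl hC, hCB, heC⟩
  · rintro ⟨h1, h2, h3⟩
    have hAT : ¬ A ⊆ {e | Sum.inl e ∈ T} := by
      have := h3 A (Or.inl rfl)
      rwa [hbelow T h1] at this
    have hAT' : ¬ Sum.inl '' A ⊆ T := fun hsub => hAT fun e he => hsub ⟨e, he, rfl⟩
    by_cases hmem : Sum.inr A ∈ T
    · right
      have hsub : T \ {Sum.inr A} ⊆ T := Set.sdiff_subset
      have hin : ∀ B, Sum.inr B ∈ T \ {Sum.inr A} → B ∈ 𝓛 := by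
        rintro B ⟨hB, hne⟩
        rcases h1 B hB with rfl | hB
        · exact absurd rfl hne
        · exact hB
      -- Replacing the label `A` by its elements must not create a covered `B`. If `B` meets `A`,
      -- then `A ∪ B` was treated earlier and would already be covered in `T`; if not, the elements
      -- of `A` do not help to cover `B`.
      have hu : T \ {Sum.inr A} ∪ Sum.inl '' A ∈ nestedFamily Δ 𝓛 := by
        have hsupp : labelSupport (T \ {Sum.inr A} ∪ Sum.inl '' A) ⊆ labelSupport T := by
          rintro e ((he | ⟨e', he', he⟩) | ⟨B, hB | ⟨e', he', hB⟩, he⟩)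
          · exact Or.inl he.1
          · obtain rfl := Sum.inl_injective he
            exact Or.inr ⟨A, hmem, he'⟩
          · exact Or.inr ⟨B, hB.1, he⟩
          · exact absurd hB (by simp)
        refine ⟨?_, hΔ hsupp h2, ?_⟩
        · rintro B (hB | ⟨e, -, hB⟩)
          · exact hin B hB
          · exact absurd hB (by simp)
        · intro B hB hBT
          have key : ∀ C, A ⊂ C → B ⊆ C → ∀ e ∈ B, e ∈ labelSupportBelow T C := by
            intro C hAC hBC e he
            rcases hBT he with (h | ⟨e', he', h⟩) | ⟨D, hD | ⟨e', he', hD⟩, hDB, heD⟩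
            · exact Or.inl h.1
            · obtain rfl := Sum.inl_injective h
              exact Or.inr ⟨A, hmem, hAC, he'⟩
            · exact Or.inr ⟨D, hD.1, hDB.trans_subset hBC, heD⟩
            · exact absurd hD (by simp)
          by_cases hint : (A ∩ B).Nonempty
          · have hAB : A ⊂ A ∪ B :=
              ⟨Set.subset_union_left, fun h => hmin B hB (Set.subset_union_right.trans h)⟩
            have hunion : A ∪ B ∈ Δ := by
              refine hΔ ?_ h2
              rintro e (he | he)
              · exact Or.inr ⟨A, hmem, he⟩
              · rcases key _ hAB Set.subset_union_right e he with h | ⟨D, hD, -, heD⟩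
                exacts [Or.inl h, Or.inr ⟨D, hD, heD⟩]
            refine h3 _ (Or.inr (hup B hB hint hunion)) ?_
            rintro e (he | he)
            · exact Or.inr ⟨A, hmem, hAB, he⟩
            · exact key _ hAB Set.subset_union_right e he
          · refine h3 B (Or.inr hB) fun e he => ?_
            rcases hBT he with (h | ⟨e', he', h⟩) | ⟨D, hD | ⟨e', he', hD⟩, hDB, heD⟩
            · exact Or.inl h.1
            · obtain rfl := Sum.inl_injective h
              exact absurd ⟨e', he', he⟩ hint
            · exact Or.inr ⟨D, hD.1, hDB, heD⟩
            · exact absurd hD (by simp)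
      refine ⟨T \ {Sum.inr A}, nestedFamily_of_subset hΔ hu Set.subset_union_left,
        fun h => hAT' (h.trans hsub), ⟨_, hu, subset_rfl⟩, ?_⟩
      rw [Set.insert_sdiff_singleton, Set.insert_eq_of_mem hmem]
    · left
      refine ⟨⟨fun B hB => ?_, h2, fun B hB => h3 B (Or.inr hB)⟩, hAT'⟩
      rcases h1 B hB with rfl | hB'
      · exact absurd hB hmem
      · exact hB'

/-- When all members of a building set have been treated, what is left are the sets of pairwise
compatible members. -/
theorem mem_nestedFamily_iff {𝓦 𝓐 : Set (Set κ)} {touch : Set κ → Set κ → Prop}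
    (hΔ : ∀ Z, Z ∈ Δ ↔ ∀ W ∈ 𝓦, ¬ W ⊆ Z) (hsub : 𝓐 ⊆ Δ)
    (hsingle : ∀ Z ∈ Δ, ∀ e ∈ Z, {e} ∈ 𝓐)
    (hunion : ∀ A ∈ 𝓐, ∀ B ∈ 𝓐, touch A B → A ∪ B ∈ Δ → A ∪ B ∈ 𝓐)
    (hconn : ∀ S ⊆ 𝓐, (∀ A ∈ S, ∀ B ∈ S, A ⊆ B ∨ B ⊆ A ∨ ¬ touch A B) →
      ∀ W ∈ 𝓐 ∪ 𝓦, W ⊆ ⋃₀ S → ∃ A ∈ S, W ⊆ A) (T : Set (κ ⊕ Set κ)) :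
    T ∈ nestedFamily Δ 𝓐 ↔ ∃ S ⊆ 𝓐, (∀ A ∈ S, ∀ B ∈ S, A ⊆ B ∨ B ⊆ A ∨ ¬ touch A B) ∧
      T = Sum.inr '' S := by
  have hlow : IsLowerSet Δ := by
    intro Z Z' hZ hmem
    rw [hΔ] at hmem ⊢
    exact fun W hW hWZ => hmem W hW (hWZ.trans hZ)
  constructor
  · rintro ⟨h1, h2, h3⟩
    refine ⟨{A | Sum.inr A ∈ T}, h1, fun A hA B hB => ?_, ?_⟩
    -- Two touching incomparable members would cover their union, a member of `𝓐`, by proper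
    -- subsets.
    · by_contra! hcon
      obtain ⟨hAB, hBA, ht⟩ := hcon
      have hle : A ∪ B ⊆ labelSupport T := by
        rintro e (he | he)
        exacts [Or.inr ⟨A, hA, he⟩, Or.inr ⟨B, hB, he⟩]
      refine h3 _ (hunion A (h1 A hA) B (h1 B hB) ht (hlow hle h2)) ?_
      rintro e (he | he)
      · exact Or.inr ⟨A, hA, ⟨Set.subset_union_left,
          fun h => hBA (Set.subset_union_right.trans h)⟩, he⟩
      · exact Or.inr ⟨B, hB, ⟨Set.subset_union_right,
          fun h => hAB (Set.subset_union_left.trans h)⟩, he⟩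
    · ext (e | A)
      · simp only [Set.mem_image, reduceCtorEq, and_false, exists_false, iff_false]
        intro he
        refine h3 {e} (hsingle _ h2 e (Or.inl he)) ?_
        rintro _ rfl
        exact Or.inl he
      · simp
  · rintro ⟨S, hS, hpair, rfl⟩
    have hle : labelSupport (Sum.inr '' S : Set (κ ⊕ Set κ)) ⊆ ⋃₀ S := by
      rintro e (⟨A, -, h⟩ | ⟨A, ⟨B, hB, h⟩, he⟩)
      · exact absurd h (by simp)
      · obtain rfl := Sum.inr_injective h
        exact ⟨B, hB, he⟩
    refine ⟨?_, ?_, ?_⟩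
    · rintro A ⟨B, hB, h⟩
      obtain rfl := Sum.inr_injective h
      exact hS hB
    · rw [hΔ]
      intro W hW hWT
      obtain ⟨A, hA, hWA⟩ := hconn S hS hpair W (Or.inr hW) (hWT.trans hle)
      exact (hΔ A).1 (hsub (hS hA)) W hW hWA
    · intro B hB hBT
      -- Applied to the members of `S` strictly inside `B`, connectedness would put `B` inside a
      -- proper subset of itself.
      obtain ⟨A, ⟨hA, hAB⟩, hBA⟩ := hconn {A ∈ S | A ⊂ B} (fun A hA => hS hA.1)
        (fun A hA C hC => hpair A hA.1 C hC.1) B (Or.inl hB) (by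
          intro e he
          rcases hBT he with ⟨A, -, h⟩ | ⟨A, ⟨C, hC, h⟩, hCB, heC⟩
          · exact absurd h (by simp)
          · obtain rfl := Sum.inr_injective h
            exact ⟨C, ⟨hC, hCB⟩, heC⟩)
      exact hAB.2 hBA

end NestedFamilies

/-! ### Faces of a product of simplices and their successive truncation -/

section SimplexProducts

variable {k : Fin 3 → ℕ}

/-- The sets of gaps that can vanish at the same time: those that do not contain all gaps of one of
the three arcs. -/
def admissibleGaps (k : Fin 3 → ℕ) : Set (Set (Particle k)) :=
  {Z | ∀ r, ∃ i, (⟨r, i⟩ : Particle k) ∉ Z}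

theorem isLowerSet_admissibleGaps : IsLowerSet (admissibleGaps k) := by
  intro Z Z' hZ hmem r
  obtain ⟨i, hi⟩ := hmem r
  exact ⟨i, fun h => hi (hZ h)⟩

theorem mem_simplexProduct {g : GapSpace k} :
    g ∈ simplexProduct k ↔ (∀ r i, 0 ≤ g r i) ∧ ∀ r, ∑ i, g r i = 1 := by
  simp only [simplexProduct, Set.mem_pi, Set.mem_univ, true_imp_iff, stdSimplex,
    Set.mem_ofPred_eq, forall_and]

theorem le_one_of_mem_simplexProduct {g : GapSpace k} (hg : g ∈ simplexProduct k) (r : Fin 3)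
    (i : Fin (k r + 1)) : g r i ≤ 1 := by
  rw [mem_simplexProduct] at hg
  rw [← hg.2 r]
  exact Finset.single_le_sum (fun j _ => hg.1 r j) (Finset.mem_univ i)

/-- The vanishing gaps of a configuration. -/
def vanishingGaps (g : GapSpace k) : Set (Particle k) :=
  {q | g q.1 q.2 = 0}

/-- The barycentre of the face: on each arc, the gaps outside `Z` share the length `1` equally. -/
theorem exists_vanishingGaps_eq {Z : Set (Particle k)} (hZ : Z ∈ admissibleGaps k) :
    ∃ g ∈ simplexProduct k, vanishingGaps g = Z := by
  classical
  have hpos : ∀ r, 0 < ({i | (⟨r, i⟩ : Particle k) ∉ Z} : Finset (Fin (k r + 1))).card := by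
    intro r
    obtain ⟨i, hi⟩ := hZ r
    exact Finset.card_pos.2 ⟨i, by simpa using hi⟩
  refine ⟨fun r i => if (⟨r, i⟩ : Particle k) ∈ Z then 0 else
    (({i | (⟨r, i⟩ : Particle k) ∉ Z} : Finset (Fin (k r + 1))).card : ℝ)⁻¹, ?_, ?_⟩
  · rw [mem_simplexProduct]
    refine ⟨fun r i => ?_, fun r => ?_⟩
    · split_ifs <;> positivity
    · have := hpos r
      rw [Finset.sum_ite]
      simp only [Finset.sum_const_zero, zero_add, Finset.sum_const, nsmul_eq_mul]
      exact mul_inv_cancel₀ (by positivity)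
  · ext ⟨r, i⟩
    have := hpos r
    simp only [vanishingGaps, Set.mem_ofPred_eq, ite_eq_left_iff, inv_eq_zero, Nat.cast_eq_zero]
    constructor
    · intro h
      by_contra hcon
      exact this.ne' (h hcon)
    · exact fun h hcon => absurd h hcon

theorem vanishingGaps_mem {g : GapSpace k} (hg : g ∈ simplexProduct k) :
    vanishingGaps g ∈ admissibleGaps k := by
  intro r
  by_contra! hcon
  have h1 := (mem_simplexProduct.1 hg).2 r
  rw [Finset.sum_eq_zero fun i _ => hcon i] at h1
  exact zero_ne_one h1

theorem isCompact_simplexProduct : IsCompact (simplexProduct k) :=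
  isCompact_univ_pi fun _ => isCompact_stdSimplex ℝ _

theorem convex_simplexProduct : Convex ℝ (simplexProduct k) :=
  convex_pi fun _ _ => convex_stdSimplex ℝ _

/-- The length of a gap as a continuous linear functional. -/
noncomputable def gapLength (q : Particle k) : GapSpace k →L[ℝ] ℝ :=
  (ContinuousLinearMap.proj (R := ℝ) (φ := fun _ : Fin (k q.1 + 1) => ℝ) q.2).comp
    (ContinuousLinearMap.proj (R := ℝ) (φ := fun r : Fin 3 => Fin (k r + 1) → ℝ) q.1)

@[simp]
theorem gapLength_apply (q : Particle k) (g : GapSpace k) : gapLength q g = g q.1 q.2 := rfl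

theorem faceLabelling_simplexProduct :
    FaceLabelling (simplexProduct k) (vanishingGaps (k := k)) := by
  classical
  refine ⟨convex_simplexProduct, isCompact_simplexProduct, ?_, ?_, ?_⟩
  · intro x hx y hy a b ha hb hab
    ext ⟨r, i⟩
    have h1 := mul_nonneg ha.le ((mem_simplexProduct.1 hx).1 r i)
    have h2 := mul_nonneg hb.le ((mem_simplexProduct.1 hy).1 r i)
    simp only [vanishingGaps, Set.mem_ofPred_eq, Set.mem_inter_iff, Pi.add_apply, Pi.smul_apply,
      smul_eq_mul]
    rw [add_eq_zero_iff_of_nonneg h1 h2, mul_eq_zero, mul_eq_zero, or_iff_right ha.ne',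
      or_iff_right hb.ne']
  · intro x hx y hy hxy
    -- As the coordinates of `y` are at most `1`, an `ε` below all positive coordinates of `x` keeps
    -- these nonnegative; the zero coordinates of `x` also vanish at `y`.
    have hev : ∀ᶠ ε : ℝ in nhdsWithin 0 (Set.Ioi 0),
        0 < ε ∧ ∀ q : Particle k, 0 < x q.1 q.2 → ε < x q.1 q.2 := by
      refine Filter.Eventually.and self_mem_nhdsWithin (Filter.eventually_all.2 fun q => ?_)
      by_cases hq : 0 < x q.1 q.2
      · filter_upwards [Ioo_mem_nhdsGT hq] with ε hε _
        exact hε.2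
      · exact Filter.Eventually.of_forall fun ε h => absurd h hq
    obtain ⟨ε, hε, hεq⟩ := hev.exists
    refine ⟨ε, hε, ?_⟩
    have hx' := mem_simplexProduct.1 hx
    have hy' := mem_simplexProduct.1 hy
    rw [mem_simplexProduct]
    refine ⟨fun r i => ?_, fun r => ?_⟩
    · simp only [Pi.add_apply, Pi.smul_apply, Pi.sub_apply, smul_eq_mul]
      rcases (hx'.1 r i).eq_or_lt with h0 | hpos
      · have h2 : (⟨r, i⟩ : Particle k) ∈ vanishingGaps y := hxy h0.symm
        have h3 : y r i = 0 := h2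
        simp [← h0, h3]
      · have h1 := hεq ⟨r, i⟩ hpos
        have h2 := le_one_of_mem_simplexProduct hy r i
        have h3 := hy'.1 r i
        simp only at h1
        nlinarith [mul_nonneg hε.le (sub_nonneg.2 h2), mul_pos hε hpos]
    · simp only [Pi.add_apply, Pi.smul_apply, Pi.sub_apply, smul_eq_mul, Finset.sum_add_distrib,
        ← Finset.mul_sum, Finset.sum_sub_distrib, hx'.2 r, hy'.2 r]
      ring
  · intro x hx
    refine ⟨-∑ q : Particle k with x q.1 q.2 = 0, gapLength q, fun y hy => ?_⟩
    have h0 : (-∑ q : Particle k with x q.1 q.2 = 0, gapLength q) x = 0 := by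
      simp only [neg_apply, sum_apply, gapLength_apply, neg_eq_zero]
      exact Finset.sum_eq_zero fun q hq => (Finset.mem_filter.1 hq).2
    have hnn : ∀ q ∈ ({q | x q.1 q.2 = 0} : Finset (Particle k)), 0 ≤ y q.1 q.2 :=
      fun q _ => (mem_simplexProduct.1 hy).1 q.1 q.2
    rw [h0]
    simp only [neg_apply, sum_apply, gapLength_apply, neg_eq_zero, Left.neg_nonpos_iff]
    refine ⟨Finset.sum_nonneg hnn, ?_⟩
    rw [Finset.sum_eq_zero_iff_of_nonneg hnn]
    constructor
    · exact fun h q hq => h q (Finset.mem_filter.2 ⟨Finset.mem_univ q, hq⟩)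
    · exact fun h q hq => h (Finset.mem_filter.1 hq).2

theorem image_vanishingGaps : vanishingGaps '' simplexProduct k = admissibleGaps k := by
  ext Z
  constructor
  · rintro ⟨g, hg, rfl⟩
    exact vanishingGaps_mem hg
  · exact fun hZ => exists_vanishingGaps_eq hZ

/-- The linear map that sends a gap vector to the lengths of the three arcs. -/
noncomputable def arcLengths (k : Fin 3 → ℕ) : GapSpace k →ₗ[ℝ] (Fin 3 → ℝ) where
  toFun g r := ∑ i, g r i
  map_add' g h := by
    ext r
    simp [Finset.sum_add_distrib]
  map_smul' a g := by
    ext r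
    simp [Finset.mul_sum]

/-- From a point with all gaps positive, a small step in any direction that keeps the arc lengths
stays in the product. -/
theorem vectorSpan_simplexProduct :
    vectorSpan ℝ (simplexProduct k) = LinearMap.ker (arcLengths k) := by
  apply le_antisymm
  · rw [vectorSpan_def, Submodule.span_le]
    rintro _ ⟨x, hx, y, hy, rfl⟩
    have hx' := (mem_simplexProduct.1 hx).2
    have hy' := (mem_simplexProduct.1 hy).2
    rw [SetLike.mem_coe, LinearMap.mem_ker]
    ext r
    simp [arcLengths, Finset.sum_sub_distrib, hx' r, hy' r]
  · intro v hv
    obtain ⟨x, hx, hx0⟩ := exists_vanishingGaps_eq (k := k) (Z := ∅) fun r => ⟨0, by simp⟩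
    have hx' := mem_simplexProduct.1 hx
    have hpos : ∀ r i, 0 < x r i := by
      intro r i
      refine (hx'.1 r i).lt_of_ne fun h => ?_
      have : (⟨r, i⟩ : Particle k) ∈ vanishingGaps x := h.symm
      simp [hx0] at this
    have hev : ∀ᶠ ε : ℝ in nhdsWithin 0 (Set.Ioi 0),
        0 < ε ∧ ∀ r i, 0 < x r i + ε * v r i := by
      refine Filter.Eventually.and self_mem_nhdsWithin
        (Filter.eventually_all.2 fun r => Filter.eventually_all.2 fun i => ?_)
      have hcont : Continuous fun ε : ℝ => x r i + ε * v r i := by fun_prop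
      exact nhdsWithin_le_nhds (hcont.continuousAt.eventually_const_lt (by simpa using hpos r i))
    obtain ⟨ε, hε, hεq⟩ := hev.exists
    have hmem : x + ε • v ∈ simplexProduct k := by
      rw [mem_simplexProduct]
      refine ⟨fun r i => (hεq r i).le, fun r => ?_⟩
      have h1 : ∑ i, v r i = 0 := congrFun (LinearMap.mem_ker.1 hv) r
      simp [Finset.sum_add_distrib, ← Finset.mul_sum, h1, hx'.2 r]
    have := Submodule.smul_mem _ ε⁻¹ (vsub_mem_vectorSpan ℝ hmem hx)
    simpa [smul_smul, inv_mul_cancel₀ hε.ne'] using this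

theorem convexDim_simplexProduct : convexDim (simplexProduct k) = ∑ r, k r := by
  have hsurj : Function.Surjective (arcLengths k) := by
    intro a
    refine ⟨fun r => Pi.single 0 (a r), ?_⟩
    ext r
    simp [arcLengths]
  have h1 := LinearMap.finrank_range_add_finrank_ker (arcLengths k)
  rw [LinearMap.range_eq_top.2 hsurj, finrank_top, ← vectorSpan_simplexProduct] at h1
  have h2 : Module.finrank ℝ (GapSpace k) = ∑ r, (k r + 1) := by
    rw [Module.finrank_pi_fintype]
    simp
  rw [h2, Finset.sum_add_distrib] at h1
  simp at h1
  rw [convexDim]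
  omega

/-- The face of the product of simplices on which the gaps in `A` vanish. -/
def vanishingFace (A : Set (Particle k)) : Set (GapSpace k) :=
  {g | g ∈ simplexProduct k ∧ ∀ e ∈ A, g e.1 e.2 = 0}

theorem vanishingFace_anti {A B : Set (Particle k)} (h : A ⊆ B) :
    vanishingFace B ⊆ vanishingFace A :=
  fun _ hg => ⟨hg.1, fun e he => hg.2 e (h he)⟩

theorem subset_of_vanishingFace_subset {A B : Set (Particle k)} (hA : A ∈ admissibleGaps k)
    (h : vanishingFace A ⊆ vanishingFace B) : B ⊆ A := by
  obtain ⟨g, hg, rfl⟩ := exists_vanishingGaps_eq hA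
  exact (h ⟨hg, fun e he => he⟩).2

theorem vanishingFace_injOn : Set.InjOn (vanishingFace (k := k)) (admissibleGaps k) :=
  fun _ hA _ hB h => (subset_of_vanishingFace_subset hB h.ge).antisymm
    (subset_of_vanishingFace_subset hA h.le)

/-- This makes an order of increasing dimension treat every proper superset of `A` before `A`. A gap
in `B` but not in `A` vanishes identically on the smaller face, though not on the larger one. -/
theorem convexDim_vanishingFace_lt {A B : Set (Particle k)} (hB : B ∈ admissibleGaps k)
    (h : A ⊂ B) : convexDim (vanishingFace B) < convexDim (vanishingFace A) := by
  obtain ⟨e, heB, heA⟩ := Set.exists_of_ssubset h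
  obtain ⟨x, hx, rfl⟩ := exists_vanishingGaps_eq (isLowerSet_admissibleGaps h.subset hB)
  obtain ⟨y, hy, rfl⟩ := exists_vanishingGaps_eq hB
  refine Submodule.finrank_lt_finrank_of_lt
    (lt_of_le_of_ne (vectorSpan_mono ℝ (vanishingFace_anti h.subset)) fun heq => ?_)
  have hle : vectorSpan ℝ (vanishingFace (vanishingGaps y)) ≤
      LinearMap.ker (gapLength e).toLinearMap := by
    rw [vectorSpan_def, Submodule.span_le]
    rintro _ ⟨v, hv, w, hw, rfl⟩
    rw [SetLike.mem_coe, LinearMap.mem_ker]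
    simp [hv.2 e heB, hw.2 e heB]
  rw [heq] at hle
  have hmem := hle (vsub_mem_vectorSpan ℝ (p₁ := x) (p₂ := y) ⟨hx, fun e he => he⟩
    ⟨hy, fun e he => h.subset he⟩)
  rw [LinearMap.mem_ker] at hmem
  have hye : y e.1 e.2 = 0 := heB
  simp only [vsub_eq_sub, ContinuousLinearMap.coe_coe, map_sub, gapLength_apply, hye,
    sub_zero] at hmem
  exact heA hmem

/-- `P` is a polytope with the face structure that arises from the product of simplices by
truncating the faces given by the members of `𝓛`. -/
def IsPartialTruncation (𝓛 : Set (Set (Particle k))) (P : Set (GapSpace k)) : Prop :=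
  P ⊆ simplexProduct k ∧ vectorSpan ℝ P = vectorSpan ℝ (simplexProduct k) ∧
    ∃ act : GapSpace k → Set (Particle k ⊕ Set (Particle k)), FaceLabelling P act ∧
      act '' P = nestedFamily (admissibleGaps k) 𝓛 ∧
      ∀ g ∈ P, ∀ e, Sum.inl e ∈ act g ↔ g e.1 e.2 = 0

theorem isPartialTruncation_empty : IsPartialTruncation ∅ (simplexProduct k) := by
  refine ⟨subset_rfl, rfl, _, faceLabelling_simplexProduct.relabel Sum.inl_injective, ?_, fun g _ e => ?_⟩
  · rw [nestedFamily_empty, ← image_vanishingGaps, Set.image_image]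
  · simp [vanishingGaps]

variable {𝓛 𝓐 : Set (Set (Particle k))} {P P' Q : Set (GapSpace k)} {A : Set (Particle k)}

theorem vanishingFace_inter_eq {act : GapSpace k → Set (Particle k ⊕ Set (Particle k))}
    (hP : P ⊆ simplexProduct k) (hact : ∀ g ∈ P, ∀ e, Sum.inl e ∈ act g ↔ g e.1 e.2 = 0) :
    vanishingFace A ∩ P = {g | g ∈ P ∧ Sum.inl '' A ⊆ act g} := by
  ext g
  constructor
  · rintro ⟨hg, hgP⟩
    refine ⟨hgP, ?_⟩
    rintro _ ⟨e, he, rfl⟩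
    exact (hact g hgP e).2 (hg.2 e he)
  · rintro ⟨hgP, hg⟩
    exact ⟨⟨hP hgP, fun e he => (hact g hgP e).1 (hg ⟨e, he, rfl⟩)⟩, hgP⟩

namespace IsPartialTruncation

theorem insert_of_isTruncation (h : IsPartialTruncation 𝓛 P) (hA : A ∈ admissibleGaps k)
    (hmin : ∀ B ∈ 𝓛, ¬ B ⊆ A)
    (hup : ∀ B ∈ 𝓛, (A ∩ B).Nonempty → A ∪ B ∈ admissibleGaps k → A ∪ B ∈ 𝓛)
    (hT : IsTruncation P (vanishingFace A ∩ P) P') : IsPartialTruncation (insert A 𝓛) P' := by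
  obtain ⟨hP, hspan, act, hlab, himg, hact⟩ := h
  refine ⟨hT.subset.trans hP, (hT.vectorSpan_eq hlab.compact hlab.convex).trans hspan, ?_⟩
  rw [vanishingFace_inter_eq hP hact] at hT
  obtain ⟨-, -, f, c, h1, h2, rfl⟩ := hT
  have hnew : ∀ x ∈ P, Sum.inr A ∉ act x := by
    intro x hx hmem
    have : act x ∈ nestedFamily (admissibleGaps k) 𝓛 := himg ▸ ⟨x, hx, rfl⟩
    exact hmin A (this.1 A hmem) subset_rfl
  refine ⟨truncationLabel act (Sum.inr A) f c, hlab.halfSpace hnew f c, ?_, ?_⟩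
  · rw [hlab.image_truncationLabel (σ := Sum.inl '' A)
      (by rw [himg]; exact image_inl_mem_nestedFamily hA hmin)
      (fun x hx hsub => h1 x ⟨hx, hsub⟩) (fun v hv hsub => h2 v hv fun h => hsub h.2), himg]
    exact stellar_nestedFamily isLowerSet_admissibleGaps hmin hup
  · intro g hg e
    rw [← hact g hg.1 e]
    simp [truncationLabel]

/-- The face to be cut is proper because the empty label still occurs, at a point where no gap
vanishes. -/
theorem exists_isTruncation (h : IsPartialTruncation 𝓛 P) (hA : A ∈ admissibleGaps k)
    (hne : A.Nonempty) (h𝓛 : ∀ B ∈ 𝓛, B.Nonempty) (hmin : ∀ B ∈ 𝓛, ¬ B ⊆ A) :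
    ∃ P', IsTruncation P (vanishingFace A ∩ P) P' := by
  obtain ⟨hP, hspan, act, hlab, himg, hact⟩ := h
  rw [vanishingFace_inter_eq hP hact]
  refine _root_.exists_isTruncation hlab.finite_extremePoints
    (hlab.isPolytopeFace (by rw [himg]; exact image_inl_mem_nestedFamily hA hmin)) fun heq => ?_
  have h0 : (Sum.inl '' (∅ : Set (Particle k)) : Set (Particle k ⊕ Set (Particle k))) ∈
      nestedFamily (admissibleGaps k) 𝓛 :=
    image_inl_mem_nestedFamily (fun r => ⟨0, by simp⟩) fun B hB hsub =>
      (h𝓛 B hB).ne_empty (Set.subset_empty_iff.1 hsub)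
  rw [← himg, Set.image_empty] at h0
  obtain ⟨x, hx, hx0⟩ := h0
  obtain ⟨e, he⟩ := hne
  have hmem : x ∈ {g | g ∈ P ∧ Sum.inl '' A ⊆ act g} := heq.ge hx
  have := hmem.2 ⟨e, he, rfl⟩
  simp [hx0] at this

end IsPartialTruncation

/-- The remaining faces in a list sorted by dimension: the list can be processed, and the result is
the full truncation. -/
theorem truncatesAlong_aux (h𝓐 : 𝓐 ⊆ admissibleGaps k) (hne : ∀ A ∈ 𝓐, A.Nonempty)
    (hunion : ∀ A ∈ 𝓐, ∀ B ∈ 𝓐, (A ∩ B).Nonempty → A ∪ B ∈ admissibleGaps k → A ∪ B ∈ 𝓐)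
    (L : List (Set (GapSpace k))) (hnodup : L.Nodup)
    (hsort : L.Pairwise fun F G => convexDim F ≤ convexDim G) (h𝓛 : 𝓛 ⊆ 𝓐)
    (hL : ∀ F, F ∈ L ↔ ∃ A ∈ 𝓐, A ∉ 𝓛 ∧ vanishingFace A = F)
    (hup : ∀ B ∈ 𝓛, ∀ A ∈ 𝓐, A ∉ 𝓛 → ¬ B ⊆ A) (hP : IsPartialTruncation 𝓛 P) :
    (∃ Q, TruncatesAlong L P Q) ∧ ∀ Q, TruncatesAlong L P Q → IsPartialTruncation 𝓐 Q := by
  induction L generalizing P 𝓛 with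
  | nil =>
    refine ⟨⟨P, .nil P⟩, ?_⟩
    rintro _ ⟨⟩
    have : 𝓛 = 𝓐 := by
      refine h𝓛.antisymm fun A hA => ?_
      by_contra hcon
      have := (hL _).2 ⟨A, hA, hcon, rfl⟩
      simp at this
    exact this ▸ hP
  | cons F L ih =>
    rw [List.nodup_cons] at hnodup
    rw [List.pairwise_cons] at hsort
    obtain ⟨A, hA, hA𝓛, rfl⟩ := (hL F).1 (by simp)
    have hmin : ∀ B ∈ 𝓛, ¬ B ⊆ A := fun B hB => hup B hB A hA hA𝓛
    have hlarger : ∀ B ∈ 𝓐, A ⊂ B → B ∈ 𝓛 := by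
      intro B hB hAB
      by_contra hcon
      have hlt := convexDim_vanishingFace_lt (h𝓐 hB) hAB
      rcases List.mem_cons.1 ((hL _).2 ⟨B, hB, hcon, rfl⟩) with heq | hmem
      · rw [heq] at hlt
        exact lt_irrefl _ hlt
      · exact absurd (hsort.1 _ hmem) (not_le.2 hlt)
    have hstep : ∀ P', IsTruncation P (vanishingFace A ∩ P) P' →
        IsPartialTruncation (insert A 𝓛) P' := fun P' hT =>
      hP.insert_of_isTruncation (h𝓐 hA) hmin (fun B hB hint hadm =>
        hlarger _ (hunion A hA B (h𝓛 hB) hint hadm) ⟨Set.subset_union_left, fun h =>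
          hmin B hB (Set.subset_union_right.trans h)⟩) hT
    have hrest : ∀ P', IsTruncation P (vanishingFace A ∩ P) P' →
        (∃ Q, TruncatesAlong L P' Q) ∧ ∀ Q, TruncatesAlong L P' Q → IsPartialTruncation 𝓐 Q := by
      intro P' hT
      refine ih hnodup.2 hsort.2 (Set.insert_subset hA h𝓛) (fun G => ?_) ?_ (hstep P' hT)
      · constructor
        · intro hG
          obtain ⟨B, hB, hB𝓛, rfl⟩ := (hL G).1 (List.mem_cons_of_mem _ hG)
          refine ⟨B, hB, ?_, rfl⟩
          rintro (rfl | h)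
          exacts [hnodup.1 hG, hB𝓛 h]
        · rintro ⟨B, hB, hB𝓛, rfl⟩
          rw [Set.mem_insert_iff, not_or] at hB𝓛
          refine (List.mem_cons.1 ((hL _).2 ⟨B, hB, hB𝓛.2, rfl⟩)).resolve_left fun heq => ?_
          exact hB𝓛.1 (vanishingFace_injOn (h𝓐 hB) (h𝓐 hA) heq)
      · rintro B (rfl | hB) C hC hC𝓛 hBC
        · rw [Set.mem_insert_iff, not_or] at hC𝓛
          exact hC𝓛.2 (hlarger C hC (hBC.ssubset_of_ne (Ne.symm hC𝓛.1)))
        · exact hup B hB C hC (fun h => hC𝓛 (Or.inr h)) hBC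
    constructor
    · obtain ⟨P', hT⟩ := hP.exists_isTruncation (h𝓐 hA) (hne A hA)
        (fun B hB => hne B (h𝓛 hB)) hmin
      obtain ⟨Q, hQ⟩ := (hrest P' hT).1
      exact ⟨Q, .cons hT hQ⟩
    · rintro Q (_ | ⟨hT, hQ⟩)
      exact (hrest _ hT).2 Q hQ

/-- Truncating the faces given by a building set, in an order of increasing dimension. -/
theorem truncatesAlong_of_buildingSet (h𝓐 : 𝓐 ⊆ admissibleGaps k) (hne : ∀ A ∈ 𝓐, A.Nonempty)
    (hunion : ∀ A ∈ 𝓐, ∀ B ∈ 𝓐, (A ∩ B).Nonempty → A ∪ B ∈ admissibleGaps k → A ∪ B ∈ 𝓐)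
    (L : List (Set (GapSpace k))) (hnodup : L.Nodup)
    (hsort : L.Pairwise fun F G => convexDim F ≤ convexDim G)
    (hL : ∀ F, F ∈ L ↔ ∃ A ∈ 𝓐, vanishingFace A = F) :
    (∃ Q, TruncatesAlong L (simplexProduct k) Q) ∧
      ∀ Q, TruncatesAlong L (simplexProduct k) Q → IsPartialTruncation 𝓐 Q :=
  truncatesAlong_aux h𝓐 hne hunion L hnodup hsort (Set.empty_subset _)
    (by simpa using hL) (by simp) isPartialTruncation_empty

end SimplexProducts

/-! ### Runs of adjacent particles -/

section Runs

variable {k : Fin 3 → ℕ}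

/-! ### Walking around the circle -/

namespace Particle

theorem next_iterate_fixed (r : Fin 3) (t : ℕ) (ht : t < k r + 1) :
    next^[t] (⟨r, 0⟩ : Particle k) = ⟨r, ⟨t, ht⟩⟩ := by
  induction t with
  | zero => rfl
  | succ t ih =>
    rw [Function.iterate_succ_apply', ih (by omega), next, dif_pos (by simpa using ht)]

theorem next_iterate_arc (r : Fin 3) :
    next^[k r + 1] (⟨r, 0⟩ : Particle k) = ⟨r + 1, 0⟩ := by
  rw [Function.iterate_succ_apply', next_iterate_fixed r (k r) (by omega), next,
    dif_neg (by simp)]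

/-- The particle that is reached from the first fixed particle in `t` steps. -/
def node (k : Fin 3 → ℕ) (t : ℕ) : Particle k :=
  next^[t] ⟨0, 0⟩

theorem next_iterate_node (s t : ℕ) : next^[t] (node k s) = node k (s + t) := by
  rw [node, node, ← Function.iterate_add_apply, add_comm]

theorem node_first : node k (k 0 + 1) = ⟨1, 0⟩ :=
  next_iterate_arc 0

theorem node_second : node k (k 0 + 1 + (k 1 + 1)) = ⟨2, 0⟩ := by
  rw [← next_iterate_node, node_first]
  exact next_iterate_arc 1

variable {n : ℕ}

theorem node_period (hk : ∑ r, k r + 2 = n) : node k (n + 1) = node k 0 := by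
  rw [Fin.sum_univ_three] at hk
  have : n + 1 = k 0 + 1 + (k 1 + 1) + (k 2 + 1) := by omega
  rw [this, ← next_iterate_node, node_second]
  exact next_iterate_arc 2

theorem exists_node_eq (hk : ∑ r, k r + 2 = n) (q : Particle k) :
    ∃ t < n + 1, node k t = q := by
  rw [Fin.sum_univ_three] at hk
  obtain ⟨r, i, hi⟩ := q
  have h0 := next_iterate_fixed r i hi
  fin_cases r
  · exact ⟨i, by simp at hi; omega, h0⟩
  · refine ⟨k 0 + 1 + i, by simp at hi; omega, ?_⟩
    rw [← next_iterate_node, node_first]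
    exact h0
  · refine ⟨k 0 + 1 + (k 1 + 1) + i, by simp at hi; omega, ?_⟩
    rw [← next_iterate_node, node_second]
    exact h0

theorem exists_iterate_eq (hk : ∑ r, k r + 2 = n) (q p : Particle k) :
    ∃ t < n + 1, next^[t] q = p := by
  obtain ⟨s, hs, rfl⟩ := exists_node_eq hk q
  obtain ⟨t, ht, rfl⟩ := exists_node_eq hk p
  rcases le_or_gt s t with h | h
  · exact ⟨t - s, by omega, by rw [next_iterate_node]; congr 1; omega⟩
  · refine ⟨t + (n + 1) - s, by omega, ?_⟩
    rw [next_iterate_node, show s + (t + (n + 1) - s) = n + 1 + t by omega,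
      ← next_iterate_node, node_period hk, next_iterate_node, zero_add]

/-- The first `n + 1` iterates reach all particles, and there are exactly `n + 1` of these. -/
theorem iterate_inj (hk : ∑ r, k r + 2 = n) (q : Particle k) {s t : ℕ} (hs : s < n + 1)
    (ht : t < n + 1) (h : next^[s] q = next^[t] q) : s = t := by
  have hsurj : Function.Surjective fun i : Fin (n + 1) => next^[i] q := by
    intro p
    obtain ⟨t, ht, h⟩ := exists_iterate_eq hk q p
    exact ⟨⟨t, ht⟩, h⟩
  have hcard : Fintype.card (Fin (n + 1)) = Fintype.card (Particle k) := by
    rw [Fintype.card_sigma, Fintype.card_fin]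
    simp only [Fintype.card_fin, Finset.sum_add_distrib]
    simp
    omega
  have hbij := (Fintype.bijective_iff_surjective_and_card _).2 ⟨hsurj, hcard⟩
  simpa using hbij.1 (a₁ := ⟨s, hs⟩) (a₂ := ⟨t, ht⟩) h

theorem node_inj (hk : ∑ r, k r + 2 = n) {s t : ℕ} (hs : s < n + 1)
    (ht : t < n + 1) (h : node k s = node k t) : s = t :=
  iterate_inj hk _ hs ht h

theorem next_injective : Function.Injective (next (k := k)) := by
  apply Finite.injective_iff_surjective.2
  intro p
  obtain ⟨t, -, h⟩ := exists_iterate_eq rfl (next p) p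
  exact ⟨next^[t] p, by rw [← Function.iterate_succ_apply' next, Function.iterate_succ_apply, h]⟩

/-- The `m` particles that follow each other, starting with `q`. -/
def run (q : Particle k) (m : ℕ) : Set (Particle k) :=
  {p | ∃ j < m, next^[j] q = p}

theorem run_mono (q : Particle k) {m m' : ℕ} (h : m ≤ m') : run q m ⊆ run q m' := by
  rintro _ ⟨j, hj, rfl⟩
  exact ⟨j, by omega, rfl⟩

theorem run_union (q : Particle k) {i m m' : ℕ} (hi : i ≤ m) :
    run q m ∪ run (next^[i] q) m' = run q (max m (i + m')) := by
  ext p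
  constructor
  · rintro (⟨j, hj, rfl⟩ | ⟨j, hj, rfl⟩)
    · exact ⟨j, by omega, rfl⟩
    · exact ⟨j + i, by omega, by rw [Function.iterate_add_apply]⟩
  · rintro ⟨j, hj, rfl⟩
    by_cases h : j < m
    · exact Or.inl ⟨j, h, rfl⟩
    · refine Or.inr ⟨j - i, by omega, ?_⟩
      rw [← Function.iterate_add_apply, show j - i + i = j by omega]

theorem compl_run (hk : ∑ r, k r + 2 = n) (q : Particle k) {m : ℕ} :
    (run q m)ᶜ = run (next^[m] q) (n + 1 - m) := by
  ext p
  obtain ⟨t, ht, rfl⟩ := exists_iterate_eq hk q p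
  constructor
  · intro h
    have hmt : m ≤ t := by
      by_contra! hcon
      exact h ⟨t, hcon, rfl⟩
    exact ⟨t - m, by omega, by rw [← Function.iterate_add_apply, Nat.sub_add_cancel hmt]⟩
  · rintro ⟨j, hj, h⟩ ⟨j', hj', h'⟩
    rw [← Function.iterate_add_apply] at h
    have h1 := iterate_inj hk q (by omega) ht h
    have h2 := iterate_inj hk q (by omega) ht h'
    omega

theorem exists_fixed_of_run_notMem {q : Particle k} {m : ℕ} (h : run q m ∉ admissibleGaps k) :
    ∃ r : Fin 3, (⟨r, 0⟩ : Particle k) ∈ run q (m + 1) ∧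
      (⟨r + 1, 0⟩ : Particle k) ∈ run q (m + 1) := by
  simp only [admissibleGaps, Set.mem_ofPred_eq, not_forall, not_exists, not_not] at h
  obtain ⟨r, hr⟩ := h
  refine ⟨r, run_mono q (by omega) (hr 0), ?_⟩
  obtain ⟨j, hj, hjr⟩ := hr (Fin.last (k r))
  refine ⟨j + 1, by omega, ?_⟩
  rw [Function.iterate_succ_apply', hjr, next, dif_neg (by simp)]

/-- Walking from one fixed particle to another visit of a fixed particle passes all gaps of the arc
that starts at the first. -/
theorem run_notMem_of_fixed {q : Particle k} {m i j : ℕ} (hij : i < j) (hj : j ≤ m)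
    (hi : (next^[i] q).IsFixed) (hj' : (next^[j] q).IsFixed) : run q m ∉ admissibleGaps k := by
  intro hadm
  set p := next^[i] q with hp
  obtain ⟨r, x⟩ := p
  obtain rfl : x = 0 := hi
  have hwalk : ∀ t (ht : t < k r + 1), next^[i + t] q = ⟨r, ⟨t, ht⟩⟩ := by
    intro t ht
    rw [add_comm, Function.iterate_add_apply, ← hp, next_iterate_fixed r t ht]
  have hlong : i + (k r + 1) ≤ j := by
    by_contra! hcon
    have h1 := hwalk (j - i) (by omega)
    rw [show i + (j - i) = j by omega] at h1
    rw [h1] at hj'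
    have h2 : j - i = 0 := congrArg Fin.val hj'
    omega
  obtain ⟨t, ht⟩ := hadm r
  exact ht ⟨i + t, by omega, hwalk t t.2⟩

theorem eq_of_fixed_mem_run {q : Particle k} {m : ℕ} (h : run q m ∈ admissibleGaps k) {r s : Fin 3}
    (hr : (⟨r, 0⟩ : Particle k) ∈ run q (m + 1)) (hs : (⟨s, 0⟩ : Particle k) ∈ run q (m + 1)) :
    r = s := by
  obtain ⟨i, hi, hir⟩ := hr
  obtain ⟨j, hj, hjs⟩ := hs
  have hif : (next^[i] q).IsFixed := by rw [hir]; rfl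
  have hjf : (next^[j] q).IsFixed := by rw [hjs]; rfl
  rcases lt_trichotomy i j with hij | rfl | hij
  · exact absurd h (run_notMem_of_fixed hij (by omega) hif hjf)
  · rw [hir] at hjs
    exact congrArg Sigma.fst hjs
  · exact absurd h (run_notMem_of_fixed hij (by omega) hjf hif)

theorem length_lt_of_run_mem (hk : ∑ r, k r + 2 = n) {q : Particle k} {m : ℕ}
    (h : run q m ∈ admissibleGaps k) : m < n := by
  by_contra! hcon
  have hall : ∀ p, p ∈ run q (m + 1) := fun p => by
    obtain ⟨t, ht, rfl⟩ := exists_iterate_eq hk q p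
    exact ⟨t, by omega, rfl⟩
  exact absurd (eq_of_fixed_mem_run h (hall ⟨0, 0⟩) (hall ⟨1, 0⟩)) (by decide)

end Particle

open Particle

/-- The sets of gaps between adjacent particles, at most one of them fixed. -/
def collisionGaps (k : Fin 3 → ℕ) : Set (Set (Particle k)) :=
  {A | A ∈ admissibleGaps k ∧ ∃ (q : Particle k) (m : ℕ), 1 ≤ m ∧ A = run q m}

/-- A run of gaps contains a whole arc exactly when its ends include a fixed particle at two
different positions, so the condition on fixed particles is admissibility. -/
theorem collisionFaces_eq : collisionFaces k = vanishingFace '' collisionGaps k := by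
  have hface : ∀ (q : Particle k) (m : ℕ), collisionFace q m = vanishingFace (run q m) := by
    intro q m
    ext g
    refine and_congr_right fun _ => ⟨?_, fun h j hj => h _ ⟨j, hj, rfl⟩⟩
    rintro h _ ⟨j, hj, rfl⟩
    exact h j hj
  ext F
  constructor
  · rintro ⟨q, m, hm, hfix, rfl⟩
    refine ⟨run q m, ⟨?_, q, m, hm, rfl⟩, (hface q m).symm⟩
    by_contra hadm
    obtain ⟨r, ⟨i, hi, hir⟩, ⟨j, hj, hjr⟩⟩ := exists_fixed_of_run_notMem hadm
    obtain rfl := hfix i (by omega) j (by omega) (by rw [hir]; rfl) (by rw [hjr]; rfl)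
    have h1 : r = r + 1 := congrArg Sigma.fst (hir.symm.trans hjr)
    exact absurd h1 ((by decide : ∀ r : Fin 3, r ≠ r + 1) r)
  · rintro ⟨_, ⟨hadm, q, m, hm, rfl⟩, rfl⟩
    refine ⟨q, m, hm, fun i hi j hj hif hjf => ?_, (hface q m).symm⟩
    rcases lt_trichotomy i j with hij | rfl | hij
    · exact absurd hadm (run_notMem_of_fixed hij (by omega) hif hjf)
    · rfl
    · exact absurd hadm (run_notMem_of_fixed hij (by omega) hjf hif)

/-- The particles at the ends of the gaps in `A`. -/
def gapEnds (A : Set (Particle k)) : Set (Particle k) :=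
  A ∪ next '' A

theorem gapEnds_mono {A B : Set (Particle k)} (h : A ⊆ B) : gapEnds A ⊆ gapEnds B :=
  Set.union_subset_union h (Set.image_mono h)

theorem gapEnds_run (q : Particle k) {m : ℕ} (hm : 1 ≤ m) : gapEnds (run q m) = run q (m + 1) := by
  ext p
  constructor
  · rintro (⟨j, hj, rfl⟩ | ⟨_, ⟨j, hj, rfl⟩, rfl⟩)
    · exact ⟨j, by omega, rfl⟩
    · exact ⟨j + 1, by omega, by rw [Function.iterate_succ_apply']⟩
  · rintro ⟨j, hj, rfl⟩
    rcases j with _ | j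
    · exact Or.inl ⟨0, by omega, rfl⟩
    · exact Or.inr ⟨_, ⟨j, by omega, rfl⟩, by rw [Function.iterate_succ_apply']⟩

/-- Two sets of gaps touch if they have a common end. -/
def Touch (A B : Set (Particle k)) : Prop :=
  (gapEnds A ∩ gapEnds B).Nonempty

/-- Stepping back from the common end by injectivity of `next`, the start of one run is found among
the ends of the other, so the two runs join. Sharing an end suffices; the building set condition
only asks for a common gap. -/
theorem union_mem_collisionGaps {A B : Set (Particle k)} (hA : A ∈ collisionGaps k)
    (hB : B ∈ collisionGaps k) (h : Touch A B) (hAB : A ∪ B ∈ admissibleGaps k) :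
    A ∪ B ∈ collisionGaps k := by
  refine ⟨hAB, ?_⟩
  obtain ⟨-, q, m, hm, rfl⟩ := hA
  obtain ⟨-, q', m', hm', rfl⟩ := hB
  rw [Touch, gapEnds_run q hm, gapEnds_run q' hm'] at h
  obtain ⟨p, ⟨i, hi, hip⟩, ⟨j, hj, hjp⟩⟩ := h
  rcases le_total i j with hij | hij
  · have hq : next^[j - i] q' = q := by
      apply next_injective.iterate i
      rw [← Function.iterate_add_apply, show i + (j - i) = j by omega, hip, hjp]
    refine ⟨q', max m' (j - i + m), by omega, ?_⟩
    rw [Set.union_comm, ← hq, run_union q' (by omega)]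
  · have hq : next^[i - j] q = q' := by
      apply next_injective.iterate j
      rw [← Function.iterate_add_apply, show j + (i - j) = i by omega, hip, hjp]
    refine ⟨q, max m (i - j + m'), by omega, ?_⟩
    rw [← hq, run_union q (by omega)]

/-- A run of gaps covered by pairwise compatible sets is covered by one of them. -/
theorem exists_run_subset {S : Set (Set (Particle k))}
    (hS : ∀ A ∈ S, ∀ B ∈ S, A ⊆ B ∨ B ⊆ A ∨ ¬ Touch A B) (q : Particle k) {m : ℕ} (hm : 1 ≤ m)
    (h : run q m ⊆ ⋃₀ S) : ∃ A ∈ S, run q m ⊆ A := by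
  induction m, hm using Nat.le_induction with
  | base =>
    obtain ⟨A, hA, hq⟩ := h ⟨0, one_pos, rfl⟩
    refine ⟨A, hA, ?_⟩
    rintro _ ⟨j, hj, rfl⟩
    obtain rfl : j = 0 := by omega
    exact hq
  | succ m hm ih =>
    obtain ⟨A, hA, hqA⟩ := ih ((run_mono q (by omega)).trans h)
    obtain ⟨B, hB, hqB⟩ := h ⟨m, by omega, rfl⟩
    have hsplit : ∀ C : Set (Particle k), run q m ⊆ C → next^[m] q ∈ C → run q (m + 1) ⊆ C := by
      rintro C h1 h2 _ ⟨j, hj, rfl⟩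
      rcases Nat.lt_succ_iff_lt_or_eq.1 hj with hj | rfl
      exacts [h1 ⟨j, hj, rfl⟩, h2]
    rcases hS A hA B hB with hAB | hBA | ht
    · exact ⟨B, hB, hsplit B (hqA.trans hAB) hqB⟩
    · exact ⟨A, hA, hsplit A hqA (hBA hqB)⟩
    -- The last gap covered by `A` and the next one, in `B`, have the particle `next^[m] q` in
    -- common.
    · refine absurd ⟨next^[m] q, Or.inr ⟨next^[m - 1] q, hqA ⟨m - 1, by omega, rfl⟩, ?_⟩,
        Or.inl hqB⟩ ht
      rw [← Function.iterate_succ_apply' next, Nat.succ_eq_add_one, Nat.sub_add_cancel hm]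

theorem nestedFamily_collisionGaps (T : Set (Particle k ⊕ Set (Particle k))) :
    T ∈ nestedFamily (admissibleGaps k) (collisionGaps k) ↔
      ∃ S ⊆ collisionGaps k, (∀ A ∈ S, ∀ B ∈ S, A ⊆ B ∨ B ⊆ A ∨ ¬ Touch A B) ∧
        T = Sum.inr '' S := by
  refine mem_nestedFamily_iff (𝓦 := Set.range fun r : Fin 3 => run (⟨r, 0⟩ : Particle k) (k r + 1))
    (fun Z => ?_) (fun A hA => hA.1) (fun Z hZ e he => ?_)
    (fun A hA B hB => union_mem_collisionGaps hA hB) (fun S _ hpair W hW hWS => ?_) T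
  · rw [Set.forall_mem_range]
    refine forall_congr' fun r => ?_
    rw [Set.not_subset]
    constructor
    · rintro ⟨i, hi⟩
      exact ⟨_, ⟨i, i.2, next_iterate_fixed r i i.2⟩, hi⟩
    · rintro ⟨_, ⟨j, hj, rfl⟩, h⟩
      rw [next_iterate_fixed r j hj] at h
      exact ⟨_, h⟩
  · refine ⟨isLowerSet_admissibleGaps (Set.singleton_subset_iff.2 he) hZ, e, 1, le_rfl, ?_⟩
    ext p
    constructor
    · rintro rfl
      exact ⟨0, one_pos, rfl⟩
    · rintro ⟨j, hj, rfl⟩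
      obtain rfl : j = 0 := by omega
      rfl
  · rcases hW with ⟨-, q, m, hm, rfl⟩ | ⟨r, rfl⟩
    · exact exists_run_subset hpair q hm hWS
    · exact exists_run_subset hpair _ (by omega) hWS

end Runs

/-! ### Runs of particles and brackets -/

section Brackets

open Particle

variable {k : Fin 3 → ℕ} {n : ℕ}

theorem eq_of_fixed_mem_gapEnds {A : Set (Particle k)} (hA : A ∈ collisionGaps k) {r s : Fin 3}
    (hr : (⟨r, 0⟩ : Particle k) ∈ gapEnds A) (hs : (⟨s, 0⟩ : Particle k) ∈ gapEnds A) : r = s := by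
  obtain ⟨hadm, q, m, hm, rfl⟩ := hA
  rw [gapEnds_run q hm] at hr hs
  exact eq_of_fixed_mem_run hadm hr hs

/-- Pigeonhole: two end sets contain at most two of the three fixed particles. -/
theorem gapEnds_union_ne_univ {A B : Set (Particle k)} (hA : A ∈ collisionGaps k)
    (hB : B ∈ collisionGaps k) : gapEnds A ∪ gapEnds B ≠ Set.univ := by
  intro h
  have hall : ∀ r : Fin 3, (⟨r, 0⟩ : Particle k) ∈ gapEnds A ∨ (⟨r, 0⟩ : Particle k) ∈ gapEnds B :=
    fun r => h.ge (Set.mem_univ _)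
  rcases hall 0 with h0 | h0 <;> rcases hall 1 with h1 | h1 <;> rcases hall 2 with h2 | h2 <;>
    first
      | exact absurd (eq_of_fixed_mem_gapEnds hA h0 h1) (by decide)
      | exact absurd (eq_of_fixed_mem_gapEnds hA h0 h2) (by decide)
      | exact absurd (eq_of_fixed_mem_gapEnds hA h1 h2) (by decide)
      | exact absurd (eq_of_fixed_mem_gapEnds hB h0 h1) (by decide)
      | exact absurd (eq_of_fixed_mem_gapEnds hB h0 h2) (by decide)
      | exact absurd (eq_of_fixed_mem_gapEnds hB h1 h2) (by decide)

/-- A run in the family has at most `n` ends, so the gap after its last end leads outside; a gap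
with both ends in the run therefore belongs to it. -/
theorem gapEnds_subset_iff (hk : ∑ r, k r + 2 = n) {A B : Set (Particle k)}
    (hB : B ∈ collisionGaps k) : gapEnds A ⊆ gapEnds B ↔ A ⊆ B := by
  refine ⟨fun h e he => ?_, gapEnds_mono⟩
  obtain ⟨hadm, q, m, hm, rfl⟩ := hB
  have hlt := length_lt_of_run_mem hk hadm
  rw [gapEnds_run q hm] at h
  obtain ⟨i, hi, rfl⟩ := h (Or.inl he)
  obtain ⟨j, hj, hji⟩ := h (Or.inr ⟨_, he, rfl⟩)
  rw [← Function.iterate_succ_apply' next] at hji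
  have := iterate_inj hk q (by omega) (by omega) hji
  exact ⟨i, by omega, rfl⟩

/-- The nodes of the path are the particles other than the root `node k 0`. A set of particles is
encoded by the nodes on the side of it that does not contain the root. -/
def awayFromRoot (n : ℕ) (C : Set (Particle k)) : Set (Fin n) :=
  {t | node k (t + 1) ∈ C ↔ node k 0 ∉ C}

theorem forall_particle_iff (hk : ∑ r, k r + 2 = n) {p : Particle k → Prop} :
    (∀ q, p q) ↔ p (node k 0) ∧ ∀ t : Fin n, p (node k (t + 1)) := by
  refine ⟨fun h => ⟨h _, fun t => h _⟩, fun h q => ?_⟩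
  obtain ⟨t, ht, rfl⟩ := exists_node_eq hk q
  rcases t with _ | t
  · exact h.1
  · exact h.2 ⟨t, by omega⟩

/-- Complementing `C` or `D` permutes the four relations `C ⊆ D`, `D ⊆ C`, disjointness, and
covering everything. The last fails for `C` and `D` by hypothesis, and for the sides away from the
root because both miss the root. -/
theorem compatible_awayFromRoot_iff (hk : ∑ r, k r + 2 = n) {C D : Set (Particle k)}
    (h : C ∪ D ≠ Set.univ) :
    (C ⊆ D ∨ D ⊆ C ∨ Disjoint C D) ↔ (awayFromRoot n C ⊆ awayFromRoot n D ∨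
      awayFromRoot n D ⊆ awayFromRoot n C ∨ Disjoint (awayFromRoot n C) (awayFromRoot n D)) := by
  rw [Ne, Set.eq_univ_iff_forall, forall_particle_iff hk] at h
  rw [Set.disjoint_left, Set.disjoint_left, Set.subset_def, Set.subset_def, Set.subset_def,
    Set.subset_def, forall_particle_iff hk, forall_particle_iff hk, forall_particle_iff hk]
  by_cases h1 : node k 0 ∈ C <;> by_cases h2 : node k 0 ∈ D <;>
    simp only [awayFromRoot, Set.mem_ofPred_eq, Set.mem_union, h1, h2, true_and, not_true,
      not_false_eq_true, iff_true, iff_false, true_imp_iff, or_true, or_false, or_self,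
      false_imp_iff, false_and, false_or, imp_false, not_forall, not_or, not_not] at h ⊢
  · obtain ⟨t, ht⟩ := h
    constructor
    · rintro (h3 | h3)
      · exact Or.inr (Or.inl fun t ht ht' => ht (h3 t ht'))
      · exact Or.inl fun t ht ht' => ht (h3 t ht')
    · rintro (h3 | h3 | h3)
      · exact Or.inr fun t ht => by_contra fun h4 => h3 t h4 ht
      · exact Or.inl fun t ht => by_contra fun h4 => h3 t h4 ht
      · exact absurd (h3 ht.1) ht.2
  · obtain ⟨t, ht⟩ := h
    constructor
    · rintro (h3 | h3)
      · exact Or.inr (Or.inr fun t ht ht' => ht (h3 t ht'))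
      · exact Or.inr (Or.inl fun t ht ht' => h3 t ht' ht)
    · rintro (h3 | h3 | h3)
      · exact absurd (h3 t ht.1) ht.2
      · exact Or.inr fun t ht ht' => h3 t ht' ht
      · exact Or.inl fun t ht => by_contra fun h4 => h3 h4 ht
  · obtain ⟨t, ht⟩ := h
    constructor
    · rintro (h3 | h3)
      · exact Or.inr (Or.inr fun t ht => h3 t ht)
      · exact Or.inl fun t ht ht' => h3 t ht ht'
    · rintro (h3 | h3 | h3)
      · exact Or.inr fun t ht ht' => h3 t ht ht'
      · exact absurd (h3 t ht.2) ht.1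
      · exact Or.inl fun t ht => h3 t ht

theorem awayFromRoot_compl (C : Set (Particle k)) : awayFromRoot n Cᶜ = awayFromRoot n C := by
  ext t
  simp only [awayFromRoot, Set.mem_ofPred_eq, Set.mem_compl_iff]
  tauto

/-- The bracket on the path that corresponds to a set of gaps. -/
noncomputable def gapBracket (n : ℕ) (A : Set (Particle k)) : Finset (Fin n) :=
  (Set.toFinite (awayFromRoot n (gapEnds A))).toFinset

theorem coe_gapBracket (A : Set (Particle k)) :
    (gapBracket n A : Set (Fin n)) = awayFromRoot n (gapEnds A) := by
  simp [gapBracket]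

/-- Equal brackets mean that the end sets are equal or complementary, and complementary end sets
would cover the circle. -/
theorem gapBracket_injOn (hk : ∑ r, k r + 2 = n) :
    Set.InjOn (gapBracket n) (collisionGaps k) := by
  intro A hA B hB h
  have h' : awayFromRoot n (gapEnds A) = awayFromRoot n (gapEnds B) := by
    rw [← coe_gapBracket, ← coe_gapBracket, h]
  have hiff : ∀ t : Fin n, (node k (t + 1) ∈ gapEnds A ↔ node k 0 ∉ gapEnds A) ↔
      (node k (t + 1) ∈ gapEnds B ↔ node k 0 ∉ gapEnds B) := fun t => Set.ext_iff.1 h' t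
  by_cases hroot : node k 0 ∈ gapEnds A ↔ node k 0 ∈ gapEnds B
  · have heq : gapEnds A = gapEnds B := by
      ext q
      revert q
      rw [forall_particle_iff hk]
      refine ⟨hroot, fun t => ?_⟩
      have := hiff t
      grind
    exact ((gapEnds_subset_iff hk hB).1 heq.le).antisymm ((gapEnds_subset_iff hk hA).1 heq.ge)
  · refine absurd (Set.eq_univ_iff_forall.2 ?_) (gapEnds_union_ne_univ hA hB)
    rw [forall_particle_iff hk]
    refine ⟨?_, fun t => ?_⟩
    · rw [Set.mem_union]
      tauto
    · have := hiff t
      rw [Set.mem_union]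
      grind

theorem compatible_gapBracket_iff (hk : ∑ r, k r + 2 = n) {A B : Set (Particle k)}
    (hA : A ∈ collisionGaps k) (hB : B ∈ collisionGaps k) :
    (A ⊆ B ∨ B ⊆ A ∨ ¬ Touch A B) ↔ (gapBracket n A ⊆ gapBracket n B ∨
      gapBracket n B ⊆ gapBracket n A ∨ Disjoint (gapBracket n A) (gapBracket n B)) := by
  rw [← gapEnds_subset_iff hk hA, ← gapEnds_subset_iff hk hB, Touch, Set.not_nonempty_iff_eq_empty,
    ← Set.disjoint_iff_inter_eq_empty,
    compatible_awayFromRoot_iff hk (gapEnds_union_ne_univ hA hB), ← coe_gapBracket,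
    ← coe_gapBracket, Finset.coe_subset, Finset.coe_subset, Finset.disjoint_coe]

theorem node_mem_run_iff (hk : ∑ r, k r + 2 = n) {s m t : ℕ} (hsm : s + m ≤ n + 1)
    (ht : t < n + 1) : node k t ∈ run (node k s) m ↔ s ≤ t ∧ t < s + m := by
  constructor
  · rintro ⟨j, hj, h⟩
    rw [next_iterate_node] at h
    have := node_inj hk (by omega) ht h
    omega
  · rintro ⟨h1, h2⟩
    exact ⟨t - s, by omega, by rw [next_iterate_node]; congr 1; omega⟩

/-- A run that does not contain the root is an interval of nodes. -/
theorem exists_Icc_of_run (hk : ∑ r, k r + 2 = n) (q : Particle k) {m : ℕ} (hm : 1 ≤ m)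
    (hroot : node k 0 ∉ run q (m + 1)) :
    ∃ i j : Fin n, i < j ∧ awayFromRoot n (run q (m + 1)) = Set.Icc i j := by
  obtain ⟨s, hs, rfl⟩ := exists_node_eq hk q
  have hs0 : s ≠ 0 := by
    rintro rfl
    exact hroot ⟨0, by omega, rfl⟩
  have hsm : s + m < n + 1 := by
    by_contra! hcon
    refine hroot ⟨n + 1 - s, by omega, ?_⟩
    rw [next_iterate_node, Nat.add_sub_cancel' hs.le, node_period hk]
  -- Node `t` of the path is the particle `node k (t + 1)`, whence the shift by one.
  refine ⟨⟨s - 1, by omega⟩, ⟨s + m - 1, by omega⟩, by simp only [Fin.mk_lt_mk]; omega, ?_⟩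
  ext t
  have ht := t.2
  simp only [awayFromRoot, Set.mem_ofPred_eq, hroot, not_false_eq_true, iff_true, Set.mem_Icc]
  rw [node_mem_run_iff hk (by omega) (by omega), Fin.le_def, Fin.le_def]
  simp only
  omega

theorem isBracket_gapBracket (hk : ∑ r, k r + 2 = n) {A : Set (Particle k)}
    (hA : A ∈ collisionGaps k) : IsBracket (gapBracket n A) := by
  have hA' := hA
  obtain ⟨hadm, q, m, hm, rfl⟩ := hA'
  have hlt := length_lt_of_run_mem hk hadm
  have hends := gapEnds_run q hm
  constructor
  · suffices ∃ i j : Fin n, i < j ∧ awayFromRoot n (gapEnds (run q m)) = Set.Icc i j by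
      obtain ⟨i, j, hij, h⟩ := this
      refine ⟨i, j, hij, ?_⟩
      rw [← Finset.coe_inj, coe_gapBracket, h, Finset.coe_Icc]
    rw [hends]
    by_cases hroot : node k 0 ∈ run q (m + 1)
    · have hc := compl_run hk q (m := m + 1)
      -- The root is itself fixed, so the other two fixed particles lie in the complement, which
      -- thus has at least two elements.
      have hm2 : m + 1 + 2 ≤ n + 1 := by
        by_contra! hcon
        have hcard : ∀ r : Fin 3, r ≠ 0 → (⟨r, 0⟩ : Particle k) = next^[m + 1] q := by
          intro r hr
          have : (⟨r, 0⟩ : Particle k) ∈ (run q (m + 1))ᶜ := fun hmem =>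
            hr (eq_of_fixed_mem_run hadm hmem hroot)
          rw [hc] at this
          obtain ⟨j, hj, h⟩ := this
          obtain rfl : j = 0 := by omega
          exact h.symm
        have h12 : (1 : Fin 3) = 2 := congrArg Sigma.fst ((hcard 1 (by decide)).trans (hcard 2 (by decide)).symm)
        exact absurd h12 (by decide)
      rw [← awayFromRoot_compl, hc, show n + 1 - (m + 1) = n + 1 - (m + 1) - 1 + 1 by omega]
      refine exists_Icc_of_run hk _ (by omega) ?_
      rw [show n + 1 - (m + 1) - 1 + 1 = n + 1 - (m + 1) by omega, ← hc]
      exact fun h => h hroot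
    · exact exists_Icc_of_run hk q hm hroot
  · intro huniv
    have hall : ∀ t : Fin n, node k (t + 1) ∈ run q (m + 1) ↔ node k 0 ∉ run q (m + 1) := by
      intro t
      have : t ∈ (gapBracket n (run q m) : Set (Fin n)) := by simp [huniv]
      rw [coe_gapBracket, hends] at this
      exact this
    by_cases hroot : node k 0 ∈ run q (m + 1)
    · have hsub : ∀ p, p ∈ run q (m + 1) → p = node k 0 := by
        rw [forall_particle_iff hk]
        exact ⟨fun _ => rfl, fun t ht => absurd hroot ((hall t).1 ht)⟩
      have h0 := hsub q ⟨0, by omega, rfl⟩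
      have h1 := hsub (next q) ⟨1, by omega, rfl⟩
      have := iterate_inj hk q (s := 0) (t := 1) (by omega) (by omega) (h0.trans h1.symm)
      omega
    · have hmem : ∀ r : Fin 3, r ≠ 0 → (⟨r, 0⟩ : Particle k) ∈ run q (m + 1) := by
        have : ∀ p, p ≠ node k 0 → p ∈ run q (m + 1) := by
          rw [forall_particle_iff hk]
          exact ⟨fun h => absurd rfl h, fun t _ => (hall t).2 hroot⟩
        exact fun r hr => this _ fun h => hr (congrArg Sigma.fst h)
      exact absurd (eq_of_fixed_mem_run hadm (hmem 1 (by decide)) (hmem 2 (by decide))) (by decide)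

/-- Of the particles in a bracket and their complement, one side contains at most one fixed particle
and comes from a run in the family. Otherwise each side would contain two of the three fixed
particles. -/
theorem exists_gapBracket_eq (hk : ∑ r, k r + 2 = n) {B : Finset (Fin n)} (hB : IsBracket B) :
    ∃ A ∈ collisionGaps k, gapBracket n A = B := by
  obtain ⟨⟨i, j, hij, rfl⟩, hne⟩ := hB
  have hj := j.2
  rw [Fin.lt_def] at hij
  set q := node k (i + 1)
  set m := (j : ℕ) - i with hm
  have hroot : node k 0 ∉ run q (m + 1) := by
    rw [node_mem_run_iff hk (by omega) (by omega)]
    omega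
  have haway : awayFromRoot n (run q (m + 1)) = (Finset.Icc i j : Finset (Fin n)) := by
    ext t
    have ht := t.2
    simp only [awayFromRoot, Set.mem_ofPred_eq, hroot, not_false_eq_true, iff_true,
      Finset.coe_Icc, Set.mem_Icc]
    rw [node_mem_run_iff hk (by omega) (by omega), Fin.le_def, Fin.le_def]
    omega
  by_cases hadm : run q m ∈ admissibleGaps k
  · refine ⟨run q m, ⟨hadm, q, m, by omega, rfl⟩, ?_⟩
    rw [← Finset.coe_inj, coe_gapBracket, gapEnds_run q (by omega), haway]
  · have hlong : m + 1 < n := by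
      by_contra! hcon
      refine hne (Finset.eq_univ_iff_forall.2 fun t => ?_)
      have ht := t.2
      rw [Finset.mem_Icc, Fin.le_def, Fin.le_def]
      omega
    have hc := compl_run hk q (m := m + 1)
    have hends : gapEnds (run (next^[m + 1] q) (n + 1 - (m + 1) - 1)) = (run q (m + 1))ᶜ := by
      rw [gapEnds_run _ (by omega), hc, Nat.sub_add_cancel (by omega)]
    refine ⟨run (next^[m + 1] q) (n + 1 - (m + 1) - 1), ⟨?_, _, _, by omega, rfl⟩, ?_⟩
    · by_contra hadm'
      obtain ⟨r, h1, h2⟩ := exists_fixed_of_run_notMem hadm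
      obtain ⟨s, h3, h4⟩ := exists_fixed_of_run_notMem hadm'
      rw [Nat.sub_add_cancel (by omega), ← hc] at h3 h4
      have hfour : ∀ r s : Fin 3, r = s ∨ r = s + 1 ∨ r + 1 = s ∨ r + 1 = s + 1 := by decide
      rcases hfour r s with h | h | h | h
      · exact h3 (h ▸ h1)
      · exact h4 (h ▸ h1)
      · exact h3 (h ▸ h2)
      · exact h4 (h ▸ h2)
    · rw [← Finset.coe_inj, coe_gapBracket, hends, awayFromRoot_compl, haway]

/-- The complete truncation of the product of simplices is an associahedron. -/
theorem IsPartialTruncation.isAssociahedron (hk : ∑ r, k r + 2 = n) {Q : Set (GapSpace k)}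
    (hQ : IsPartialTruncation (collisionGaps k) Q) : IsAssociahedron n Q := by
  obtain ⟨-, hspan, act, hlab, himg, -⟩ := hQ
  have hnon : Q.Nonempty := by
    have h0 : (Sum.inr '' ∅ : Set (Particle k ⊕ Set (Particle k))) ∈ act '' Q := by
      rw [himg, nestedFamily_collisionGaps]
      exact ⟨∅, Set.empty_subset _, by simp, rfl⟩
    obtain ⟨x, hx, -⟩ := h0
    exact ⟨x, hx⟩
  refine ⟨hlab.isPolytope hnon, ?_, ⟨hlab.facePosetIso.symm.trans ?_⟩⟩
  · rw [convexDim, hspan, ← convexDim, convexDim_simplexProduct, hk]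
  rw [himg]
  have hS : ∀ T ∈ nestedFamily (admissibleGaps k) (collisionGaps k),
      {A | Sum.inr A ∈ T} ⊆ collisionGaps k ∧
      (∀ A, Sum.inr A ∈ T → ∀ B, Sum.inr B ∈ T → A ⊆ B ∨ B ⊆ A ∨ ¬ Touch A B) ∧
      T = Sum.inr '' {A | Sum.inr A ∈ T} := by
    intro T hT
    obtain ⟨S, hS, hpair, rfl⟩ := (nestedFamily_collisionGaps T).1 hT
    simp only [Set.mem_image, Sum.inr.injEq, exists_eq_right]
    exact ⟨hS, hpair, rfl⟩
  -- Labels are taken with the dual order, and bracketings are ordered by reverse inclusion, so the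
  -- bijection between runs and brackets preserves the order.
  refine RelIso.ofSurjective (OrderEmbedding.ofMapLEIff
    (fun T : (nestedFamily (admissibleGaps k) (collisionGaps k))ᵒᵈ =>
      (⟨(Set.toFinite (gapBracket n '' {A | Sum.inr A ∈ (OrderDual.ofDual T).1})).toFinset,
        ?_, ?_⟩ : Bracketing n)) ?_) ?_
  · intro B hB
    rw [Set.Finite.mem_toFinset] at hB
    obtain ⟨A, hA, rfl⟩ := hB
    exact isBracket_gapBracket hk ((hS _ (OrderDual.ofDual T).2).1 hA)
  · intro B hB C hC
    rw [Set.Finite.mem_toFinset] at hB hC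
    obtain ⟨A, hA, rfl⟩ := hB
    obtain ⟨A', hA', rfl⟩ := hC
    obtain ⟨h1, h2, -⟩ := hS _ (OrderDual.ofDual T).2
    exact (compatible_gapBracket_iff hk (h1 hA) (h1 hA')).1 (h2 A hA A' hA')
  · rintro ⟨T, hT⟩ ⟨T', hT'⟩
    change (Set.toFinite (gapBracket n '' {A | Sum.inr A ∈ T'})).toFinset ⊆
      (Set.toFinite (gapBracket n '' {A | Sum.inr A ∈ T})).toFinset ↔ T' ⊆ T
    rw [Set.Finite.toFinset_subset_toFinset,
      (gapBracket_injOn hk).image_subset_image_iff (hS T' hT').1 (hS T hT).1]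
    constructor
    · intro h
      rw [(hS T' hT').2.2, (hS T hT).2.2]
      exact Set.image_mono h
    · exact fun h A hA => h hA
  · rintro ⟨S, hS1, hS2⟩
    refine ⟨OrderDual.toDual ⟨Sum.inr '' {A | A ∈ collisionGaps k ∧ gapBracket n A ∈ S}, ?_⟩, ?_⟩
    · rw [nestedFamily_collisionGaps]
      exact ⟨_, fun A hA => hA.1, fun A hA B hB =>
        (compatible_gapBracket_iff hk hA.1 hB.1).2 (hS2 _ hA.2 _ hB.2), rfl⟩
    · apply Subtype.ext
      ext B
      change B ∈ (Set.toFinite (gapBracket n '' {A | Sum.inr A ∈ (Sum.inr ''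
        {A | A ∈ collisionGaps k ∧ gapBracket n A ∈ S} :
          Set (Particle k ⊕ Set (Particle k)))})).toFinset ↔ B ∈ S
      rw [Set.Finite.mem_toFinset]
      simp only [Set.mem_image, Sum.inr.injEq, exists_eq_right, Set.mem_ofPred_eq]
      constructor
      · rintro ⟨A, ⟨-, h⟩, rfl⟩
        exact h
      · intro hB
        obtain ⟨A, hA, rfl⟩ := exists_gapBracket_eq hk (hS1 B hB)
        exact ⟨A, ⟨hA, hB⟩, rfl⟩

theorem collisionTruncation (hk : ∑ r, k r + 2 = n) :
    (∃ Q, IsCollisionTruncation k Q) ∧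
      ∀ Q, IsCollisionTruncation k Q → IsAssociahedron n Q := by
  have key := fun L => truncatesAlong_of_buildingSet (𝓐 := collisionGaps k) (fun A hA => hA.1)
    (by
      rintro _ ⟨-, q, m, hm, rfl⟩
      exact ⟨q, 0, by omega, rfl⟩)
    (fun A hA B hB hint hAB => union_mem_collisionGaps hA hB
      (hint.mono (Set.inter_subset_inter Set.subset_union_left Set.subset_union_left)) hAB) L
  constructor
  · have hfin : (collisionFaces k).Finite := by
      rw [collisionFaces_eq]
      exact (Set.toFinite _).image _
    have hle := List.pairwise_insertionSort
      (fun F G : Set (GapSpace k) => convexDim F ≤ convexDim G) hfin.toFinset.toList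
    have hmem : ∀ F, F ∈ hfin.toFinset.toList.insertionSort
        (fun F G : Set (GapSpace k) => convexDim F ≤ convexDim G) ↔ F ∈ collisionFaces k := by
      simp
    have hnodup := (List.perm_insertionSort (fun F G : Set (GapSpace k) =>
      convexDim F ≤ convexDim G) hfin.toFinset.toList).nodup_iff.2 hfin.toFinset.nodup_toList
    obtain ⟨Q, hQ⟩ := (key _ hnodup hle fun F => by rw [hmem, collisionFaces_eq]; rfl).1
    exact ⟨Q, _, hnodup, hmem, hle, hQ⟩
  · rintro Q ⟨L, hnodup, hmem, hsort, hQ⟩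
    exact ((key L hnodup hsort fun F => by rw [hmem, collisionFaces_eq]; rfl).2 Q
      hQ).isAssociahedron hk

end Brackets

/-! ### Combinatorial types of products of simplices -/

section Counting

/-- The elements that cover a minimal element. -/
def IsBottomCover {α : Type*} [Preorder α] (a : α) : Prop :=
  ∃ b, IsMin b ∧ b ⋖ a

/-- The bottom covers that lie below all maximal elements that are not above `a`. -/
def siblings {α : Type*} [Preorder α] (a : α) : Set α :=
  {a' | IsBottomCover a' ∧ ∀ b, IsMax b → ¬ a ≤ b → a' ≤ b}

/-! ### Invariance under order isomorphisms -/

section OrderIso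

variable {α β : Type*} [PartialOrder α] [PartialOrder β]

theorem OrderIso.isBottomCover_apply (φ : α ≃o β) {a : α} :
    IsBottomCover (φ a) ↔ IsBottomCover a := by
  constructor
  · rintro ⟨b, hb, hba⟩
    refine ⟨φ.symm b, φ.symm.isMin_apply.2 hb, ?_⟩
    rwa [← apply_covBy_apply_iff φ, φ.apply_symm_apply]
  · rintro ⟨b, hb, hba⟩
    exact ⟨φ b, φ.isMin_apply.2 hb, (apply_covBy_apply_iff φ).2 hba⟩

theorem OrderIso.siblings_apply (φ : α ≃o β) (a : α) : siblings (φ a) = φ '' siblings a := by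
  ext b
  obtain ⟨c, rfl⟩ := φ.surjective b
  rw [φ.injective.mem_set_image]
  refine and_congr φ.isBottomCover_apply ?_
  rw [φ.surjective.forall]
  simp only [φ.isMax_apply, φ.le_iff_le]

theorem OrderIso.ncard_setOf_siblings (φ : α ≃o β) (j : ℕ) :
    {a : α | IsBottomCover a ∧ (siblings a).ncard = j}.ncard =
      {b : β | IsBottomCover b ∧ (siblings b).ncard = j}.ncard := by
  rw [← Set.ncard_image_of_injective _ φ.injective]
  congr 1
  ext b
  obtain ⟨c, rfl⟩ := φ.surjective b
  rw [φ.injective.mem_set_image, Set.mem_ofPred_eq, Set.mem_ofPred_eq,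
    φ.isBottomCover_apply, φ.siblings_apply, Set.ncard_image_of_injective _ φ.injective]

end OrderIso

variable {k k' : Fin 3 → ℕ}

/-! ### Recovering the factors from the poset of admissible sets -/

theorem singleton_mem_admissibleGaps {e : Particle k} :
    {e} ∈ admissibleGaps k ↔ 1 ≤ k e.1 := by
  obtain ⟨r, i⟩ := e
  constructor
  · intro h
    obtain ⟨j, hj⟩ := h r
    by_contra! hcon
    have hi := i.2
    have hj' := j.2
    refine hj ?_
    rw [Set.mem_singleton_iff, show j = i from Fin.ext (by simp only at hcon; omega)]
  · intro h s
    by_cases hs : s = r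
    · subst hs
      have : Nontrivial (Fin (k s + 1)) := Fin.nontrivial_iff_two_le.2 (by simp only at h; omega)
      obtain ⟨j, hj⟩ := exists_ne i
      exact ⟨j, by simpa using hj⟩
    · exact ⟨0, fun h => hs (congrArg Sigma.fst h)⟩

theorem empty_mem_admissibleGaps : (∅ : Set (Particle k)) ∈ admissibleGaps k :=
  fun _ => ⟨0, by simp⟩

theorem isMin_admissibleGaps {Z : admissibleGaps k} : IsMin Z ↔ Z.1 = ∅ := by
  constructor
  · intro h
    exact Set.subset_empty_iff.1 (h (b := ⟨∅, empty_mem_admissibleGaps⟩) (Set.empty_subset _))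
  · intro h W _
    change Z.1 ⊆ W.1
    rw [h]
    exact Set.empty_subset _

theorem isBottomCover_admissibleGaps {Z : admissibleGaps k} :
    IsBottomCover Z ↔ ∃ e, Z.1 = {e} := by
  constructor
  · rintro ⟨B, hB, hlt, hcov⟩
    rw [isMin_admissibleGaps] at hB
    have hne : Z.1.Nonempty := by
      rw [Set.nonempty_iff_ne_empty]
      exact fun h => hlt.ne (Subtype.ext (hB.trans h.symm))
    obtain ⟨e, he⟩ := hne
    have hsub : {e} ⊆ Z.1 := Set.singleton_subset_iff.2 he
    refine ⟨e, by_contra fun hcon => ?_⟩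
    refine hcov (c := ⟨{e}, isLowerSet_admissibleGaps hsub Z.2⟩) ?_
      (lt_of_le_of_ne hsub fun h => hcon (congrArg Subtype.val h).symm)
    refine lt_of_le_of_ne (show B.1 ⊆ {e} from hB ▸ Set.empty_subset _) fun h => ?_
    have h' : B.1 = {e} := congrArg Subtype.val h
    rw [hB] at h'
    exact (Set.singleton_ne_empty e) h'.symm
  · rintro ⟨e, he⟩
    refine ⟨⟨∅, empty_mem_admissibleGaps⟩, isMin_admissibleGaps.2 rfl, ?_, ?_⟩
    · refine lt_of_le_of_ne (Set.empty_subset _) fun h => ?_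
      have h' : ∅ = Z.1 := congrArg Subtype.val h
      rw [he] at h'
      exact (Set.singleton_ne_empty e) h'.symm
    · intro W h1 h2
      have h3 : W.1 ⊆ {e} := he ▸ h2.le
      rcases Set.subset_singleton_iff_eq.1 h3 with h | h
      · exact h1.ne (Subtype.ext h.symm)
      · exact h2.ne (Subtype.ext (h.trans he.symm))

/-- A maximal admissible set, that is a vertex, omits exactly one gap of each arc. Hence omitting
`e` forces `e'` in only when they compete on the same arc. -/
theorem forall_isMax_iff {e e' : Particle k} :
    (∀ Z : admissibleGaps k, IsMax Z → e ∉ Z.1 → e' ∈ Z.1) ↔ e'.1 = e.1 ∧ e' ≠ e := by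
  classical
  constructor
  · intro h
    by_contra hcon
    -- One omitted gap per arc, chosen so that both `e` and `e'` are omitted.
    set c : ∀ r, Fin (k r + 1) := Function.update (Function.update 0 e'.1 e'.2) e.1 e.2 with hc
    have hce : c e.1 = e.2 := by simp [hc]
    have hce' : c e'.1 = e'.2 := by
      by_cases h1 : e'.1 = e.1
      · obtain rfl : e' = e := by_contra fun h2 => hcon ⟨h1, h2⟩
        exact hce
      · simp [hc, h1]
    have hadm : {q : Particle k | q.2 ≠ c q.1} ∈ admissibleGaps k := fun r => ⟨c r, by simp⟩
    refine absurd hce'.symm (h ⟨_, hadm⟩ ?_ (by simp [hce]))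
    rintro ⟨W, hW⟩ hle ⟨r, i⟩ hq hqc
    obtain ⟨j, hj⟩ := hW r
    by_cases hjc : j = c r
    · exact hj (by rw [hjc, ← show i = c r from hqc]; exact hq)
    · exact hj (hle (show (⟨r, j⟩ : Particle k) ∈ {q : Particle k | q.2 ≠ c q.1} from hjc))
  · rintro ⟨h1, h2⟩ ⟨Z, hZ⟩ hmax he
    have hadm : insert e' Z ∈ admissibleGaps k := by
      intro r
      by_cases hr : r = e.1
      · subst hr
        refine ⟨e.2, ?_⟩
        rintro (h | h)
        exacts [h2 h.symm, he h]
      · obtain ⟨i, hi⟩ := hZ r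
        refine ⟨i, ?_⟩
        rintro (h | h)
        · exact hr ((congrArg Sigma.fst h).trans h1)
        · exact hi h
    exact hmax (b := ⟨_, hadm⟩) (Set.subset_insert _ _) (Set.mem_insert _ _)

theorem ncard_siblings {Z : admissibleGaps k} {e : Particle k} (hZ : Z.1 = {e}) :
    (siblings Z).ncard = k e.1 := by
  have hpos : 1 ≤ k e.1 := by
    rw [← singleton_mem_admissibleGaps, ← hZ]
    exact Z.2
  let f : Fin (k e.1 + 1) → admissibleGaps k := fun i =>
    ⟨{⟨e.1, i⟩}, singleton_mem_admissibleGaps.2 hpos⟩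
  have hf : Function.Injective f := by
    intro i j h
    have := Set.singleton_injective (congrArg Subtype.val h)
    simpa using this
  have hsib : siblings Z = f '' {e.2}ᶜ := by
    ext W
    have hle : ∀ {V : admissibleGaps k} {q : Particle k}, V.1 = {q} →
        ∀ Y : admissibleGaps k, V ≤ Y ↔ q ∈ Y.1 := by
      intro V q hV Y
      rw [← Subtype.coe_le_coe, hV]
      exact Set.singleton_subset_iff
    constructor
    · rintro ⟨hW, h⟩
      obtain ⟨e', he'⟩ := isBottomCover_admissibleGaps.1 hW
      simp only [hle hZ, hle he'] at h
      obtain ⟨h1, h2⟩ := forall_isMax_iff.1 h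
      obtain ⟨r, i⟩ := e'
      obtain ⟨s, j⟩ := e
      obtain rfl : r = s := h1
      exact ⟨i, fun hij => h2 (by rw [show i = j from hij]), Subtype.ext he'.symm⟩
    · rintro ⟨i, hi, rfl⟩
      refine ⟨isBottomCover_admissibleGaps.2 ⟨_, rfl⟩, ?_⟩
      simp only [hle hZ, hle (V := f i) rfl]
      exact forall_isMax_iff.2 ⟨rfl, fun h => hi (by
        obtain ⟨r, j⟩ := e
        simpa using h)⟩
  rw [hsib, Set.ncard_image_of_injective _ hf, Set.ncard_compl, Set.ncard_singleton]
  simp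

/-- Each arc with `j + 1` gaps contributes all of them. The case `j = 0` is excluded because the
only gap of such an arc cannot vanish. -/
theorem ncard_setOf_siblings_admissibleGaps {j : ℕ} (hj : 1 ≤ j) :
    {Z : admissibleGaps k | IsBottomCover Z ∧ (siblings Z).ncard = j}.ncard =
      Fintype.card {r // k r = j} * (j + 1) := by
  let f : {e : Particle k // k e.1 = j} → admissibleGaps k := fun e =>
    ⟨{e.1}, singleton_mem_admissibleGaps.2 (by rw [e.2]; exact hj)⟩
  have hf : Function.Injective f := fun e e' h =>
    Subtype.ext (Set.singleton_injective (congrArg Subtype.val h))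
  have hrange : {Z : admissibleGaps k | IsBottomCover Z ∧ (siblings Z).ncard = j} =
      Set.range f := by
    ext Z
    constructor
    · rintro ⟨hZ, hcard⟩
      obtain ⟨e, he⟩ := isBottomCover_admissibleGaps.1 hZ
      rw [ncard_siblings he] at hcard
      exact ⟨⟨e, hcard⟩, Subtype.ext he.symm⟩
    · rintro ⟨e, rfl⟩
      exact ⟨isBottomCover_admissibleGaps.2 ⟨_, rfl⟩, (ncard_siblings rfl).trans e.2⟩
  rw [hrange, ← Nat.card_coe_set_eq, Nat.card_range_of_injective hf,
    Nat.card_congr (Equiv.subtypeSigmaEquiv _ fun r => k r = j), Nat.card_eq_fintype_card,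
    Fintype.card_sigma]
  simp only [Fintype.card_fin]
  rw [Finset.sum_congr rfl fun r _ => by rw [r.2]]
  simp

/-- The face poset of a product of simplices is dual to the poset of admissible sets of gaps. -/
noncomputable def facePosetSimplexProductIso (k : Fin 3 → ℕ) :
    FacePoset (simplexProduct k) ≃o (admissibleGaps k)ᵒᵈ :=
  faceLabelling_simplexProduct.facePosetIso.symm.trans
    (OrderIso.dual (OrderIso.setCongr _ _ image_vanishingGaps))

theorem card_eq_of_facePoset_iso
    (e : FacePoset (simplexProduct k) ≃o FacePoset (simplexProduct k')) {j : ℕ} (hj : 1 ≤ j) :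
    Fintype.card {r // k r = j} = Fintype.card {r // k' r = j} := by
  have φ : admissibleGaps k ≃o admissibleGaps k' :=
    (((facePosetSimplexProductIso k).symm.trans e).trans (facePosetSimplexProductIso k')).dual
  have h := φ.ncard_setOf_siblings j
  rw [ncard_setOf_siblings_admissibleGaps hj, ncard_setOf_siblings_admissibleGaps hj] at h
  exact Nat.eq_of_mul_eq_mul_right (Nat.succ_pos j) h

theorem nonempty_facePoset_iso_of_perm (σ : Equiv.Perm (Fin 3)) (hσ : ∀ r, k' (σ r) = k r) :
    Nonempty (FacePoset (simplexProduct k) ≃o FacePoset (simplexProduct k')) := by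
  let E : Particle k ≃ Particle k' :=
    Equiv.sigmaCongr σ fun r => finCongr (by rw [hσ])
  have hE : ∀ r i, (E ⟨r, i⟩).1 = σ r := fun r i => rfl
  have hmem : ∀ Z, E '' Z ∈ admissibleGaps k' ↔ Z ∈ admissibleGaps k := by
    intro Z
    constructor
    · intro h r
      obtain ⟨i, hi⟩ := h (σ r)
      obtain ⟨⟨s, j⟩, hs⟩ := E.surjective ⟨σ r, i⟩
      obtain rfl : s = r := σ.injective (by rw [← hE s j, hs])
      exact ⟨j, fun hj => hi (hs ▸ ⟨_, hj, rfl⟩)⟩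
    · intro h s
      obtain ⟨r, rfl⟩ := σ.surjective s
      obtain ⟨i, hi⟩ := h r
      refine ⟨(E ⟨r, i⟩).2, ?_⟩
      rintro ⟨q, hq, hqi⟩
      exact hi (E.injective (show E q = E ⟨r, i⟩ from hqi) ▸ hq)
  have φ : admissibleGaps k ≃o admissibleGaps k' :=
    RelIso.ofSurjective (OrderEmbedding.ofMapLEIff
      (fun Z => (⟨E '' Z.1, (hmem _).2 Z.2⟩ : admissibleGaps k'))
      fun Z W => Set.image_subset_image_iff E.injective)
      (by
        rintro ⟨W, hW⟩
        have hEW : E '' (E ⁻¹' W) = W := Set.image_preimage_eq W E.surjective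
        exact ⟨⟨E ⁻¹' W, (hmem _).1 (hEW.symm ▸ hW)⟩, Subtype.ext hEW⟩)
  exact ⟨((facePosetSimplexProductIso k).trans φ.dual).trans (facePosetSimplexProductIso k').symm⟩

/-- The positive dimensions of the factors of a product of simplices. -/
def positiveParts (k : Fin 3 → ℕ) : Multiset ℕ :=
  (Finset.univ.val.map k).filter (· ≠ 0)

theorem count_positiveParts {j : ℕ} (hj : j ≠ 0) :
    (positiveParts k).count j = Fintype.card {r // k r = j} := by
  rw [positiveParts, Multiset.count_filter_of_pos (p := (· ≠ 0)) hj, Multiset.count_map, Fintype.card_subtype]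
  simp only [eq_comm (a := j)]
  rfl

/-- Point factors leave no trace in the face poset, but their number is known since there are three
factors in all. -/
theorem positiveParts_eq_iff :
    positiveParts k = positiveParts k' ↔
      Nonempty (FacePoset (simplexProduct k) ≃o FacePoset (simplexProduct k')) := by
  constructor
  · intro h
    have hpos : ∀ j, j ≠ 0 → Fintype.card {r // k r = j} = Fintype.card {r // k' r = j} :=
      fun j hj => by rw [← count_positiveParts hj, h, count_positiveParts hj]
    have hzero : Fintype.card {r // k r = 0} = Fintype.card {r // k' r = 0} := by
      have hcompl : ∀ k : Fin 3 → ℕ, Fintype.card {r // k r = 0} =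
          3 - (positiveParts k).card := by
        intro k
        have h1 := Multiset.filter_add_not (fun j => j ≠ 0) (Finset.univ.val.map k)
        have h2 := congrArg Multiset.card h1
        rw [Multiset.card_add, Multiset.card_map] at h2
        simp only [not_not] at h2
        rw [← Multiset.countP_eq_card_filter (fun j => j = 0), Multiset.countP_map] at h2
        rw [Fintype.card_subtype]
        change (positiveParts k).card + (Finset.univ.filter fun r => k r = 0).card = 3 at h2
        omega
      rw [hcompl, hcompl, h]
    have hall : ∀ j, Fintype.card {r // k r = j} = Fintype.card {r // k' r = j} := fun j => by
      rcases eq_or_ne j 0 with rfl | hj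
      exacts [hzero, hpos j hj]
    exact nonempty_facePoset_iso_of_perm
      (Equiv.ofFiberEquiv (f := k) (g := k') fun j => Fintype.equivOfCardEq (hall j))
      fun r => Equiv.ofFiberEquiv_map _ r
  · rintro ⟨e⟩
    ext j
    rcases eq_or_ne j 0 with rfl | hj
    · simp [positiveParts]
    · rw [count_positiveParts hj, count_positiveParts hj,
        card_eq_of_facePoset_iso e (Nat.one_le_iff_ne_zero.2 hj)]

theorem image_positiveParts (m : ℕ) :
    positiveParts '' {k | ∑ r, k r = m} =
      Nat.Partition.parts '' {p : Nat.Partition m | p.parts.card ≤ 3} := by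
  ext s
  constructor
  · rintro ⟨k, hk, rfl⟩
    refine ⟨Nat.Partition.ofSums m (Finset.univ.val.map k) hk, ?_, rfl⟩
    exact (Multiset.card_le_card (Multiset.filter_le _ _)).trans (Multiset.card_map k Finset.univ.val).le
  · rintro ⟨p, hp, rfl⟩
    -- Zeros are added to make exactly three parts; `positiveParts` discards them again.
    have hcard : (p.parts + Multiset.replicate (3 - p.parts.card) 0).card = 3 := by
      have : p.parts.card ≤ 3 := hp
      rw [Multiset.card_add, Multiset.card_replicate]
      omega
    obtain ⟨x, y, z, h⟩ := Multiset.card_eq_three.1 hcard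
    have hmap : Finset.univ.val.map ![x, y, z] =
        p.parts + Multiset.replicate (3 - p.parts.card) 0 := by
      rw [h]
      rfl
    refine ⟨![x, y, z], ?_, ?_⟩
    · change (Finset.univ.val.map ![x, y, z]).sum = m
      rw [hmap]
      simp [p.parts_sum]
    · rw [positiveParts, hmap, Multiset.filter_add]
      have h1 : Multiset.filter (· ≠ 0) p.parts = p.parts :=
        Multiset.filter_eq_self.2 fun i hi => (p.parts_pos hi).ne'
      have h2 : Multiset.filter (· ≠ 0) (Multiset.replicate (3 - p.parts.card) 0) = 0 :=
        Multiset.filter_eq_nil.2 fun i hi => not_not.2 (Multiset.eq_of_mem_replicate hi)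
      rw [h1, h2, add_zero]

/-- This is the summand `1` of the count. It also covers `m = 0`, where the only partition has no
parts. -/
theorem card_parts_le_one_iff {m : ℕ} (p : Nat.Partition m) :
    p.parts.card ≤ 1 ↔ p = Nat.Partition.indiscrete m := by
  rcases eq_or_ne m 0 with rfl | hm
  · simp [Subsingleton.elim p (Nat.Partition.indiscrete 0)]
  · constructor
    · intro h
      apply Nat.Partition.ext
      rw [Nat.Partition.indiscrete_parts hm]
      have hsum := p.parts_sum
      rcases Nat.le_one_iff_eq_zero_or_eq_one.1 h with h | h
      · rw [Multiset.card_eq_zero.1 h, Multiset.sum_zero] at hsum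
        exact absurd hsum.symm hm
      · obtain ⟨a, ha⟩ := Multiset.card_eq_one.1 h
        rw [ha, Multiset.sum_singleton] at hsum
        rw [ha, hsum]
    · rintro rfl
      simp [Nat.Partition.indiscrete_parts hm]

theorem ncard_partitions_le_three (m : ℕ) :
    {p : Nat.Partition m | p.parts.card ≤ 3}.ncard =
      partitionsIntoParts 3 m + partitionsIntoParts 2 m + 1 := by
  have hparts : ∀ j, partitionsIntoParts j m = {p : Nat.Partition m | p.parts.card = j}.ncard :=
    fun j => by
      rw [partitionsIntoParts, ← Nat.card_eq_fintype_card, ← Nat.card_coe_set_eq]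
      rfl
  have hunion : {p : Nat.Partition m | p.parts.card ≤ 3} =
      ({p | p.parts.card = 3} ∪ {p | p.parts.card = 2}) ∪ {Nat.Partition.indiscrete m} := by
    ext p
    simp only [Set.mem_union, Set.mem_ofPred_eq, Set.mem_singleton_iff, ← card_parts_le_one_iff]
    omega
  rw [hunion, Set.ncard_union_eq, Set.ncard_union_eq, ← hparts, ← hparts, Set.ncard_singleton]
  · rw [Set.disjoint_left]
    intro p h1 h2
    simp only [Set.mem_ofPred_eq] at h1 h2
    omega
  · rw [Set.disjoint_singleton_right, Set.mem_union, Set.mem_ofPred_eq, Set.mem_ofPred_eq]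
    have := (card_parts_le_one_iff (Nat.Partition.indiscrete m)).2 rfl
    omega

theorem Set.ncard_image_eq_of_eq_iff {α β γ : Type*} {s : Set α} {f : α → β} {g : α → γ}
    (h : ∀ x ∈ s, ∀ y ∈ s, f x = f y ↔ g x = g y) : (f '' s).ncard = (g '' s).ncard := by
  refine Set.ncard_congr (fun b hb => g hb.choose) (fun b hb => ⟨_, hb.choose_spec.1, rfl⟩) ?_ ?_
  · intro b c hb hc heq
    rw [← hb.choose_spec.2, ← hc.choose_spec.2]
    exact (h _ hb.choose_spec.1 _ hc.choose_spec.1).2 heq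
  · rintro _ ⟨x, hx, rfl⟩
    have hb : f x ∈ f '' s := ⟨x, hx, rfl⟩
    exact ⟨_, hb, (h _ hb.choose_spec.1 _ hx).1 hb.choose_spec.2⟩

/-! ### Invariance of the dimension under iterated truncation -/

section Dimension

variable {E : Type*} [NormedAddCommGroup E] [NormedSpace ℝ E] {P Q : Set E}

theorem IsIteratedTruncation.convexDim_eq (hPc : IsCompact P) (hP : Convex ℝ P)
    (h : IsIteratedTruncation P Q) : convexDim Q = convexDim P := by
  -- Compactness and convexity are carried along because each further truncation needs them.
  suffices IsCompact Q ∧ Convex ℝ Q ∧ convexDim Q = convexDim P from this.2.2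
  induction h with
  | refl => exact ⟨hPc, hP, rfl⟩
  | tail _ hT ih =>
    obtain ⟨F, hT⟩ := hT
    obtain ⟨h1, h2, h3⟩ := ih
    refine ⟨hT.isCompact h1, hT.convex h2, ?_⟩
    rw [← h3, convexDim, hT.vectorSpan_eq h1 h2, convexDim]

theorem TruncatesAlong.isIteratedTruncation {L : List (Set E)} (h : TruncatesAlong L P Q) :
    IsIteratedTruncation P Q := by
  induction h with
  | nil P => exact .refl
  | cons hT _ ih => exact .head ⟨_, hT⟩ ih

end Dimension

theorem associahedronSources_eq {n : ℕ} (hn : 2 ≤ n) :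
    associahedronSources n = Quotient.mk simplexProductSetoid '' {k | ∑ r, k r = n - 2} := by
  ext T
  constructor
  · rintro ⟨k, rfl, Q, hQ, hass⟩
    refine ⟨k, ?_, rfl⟩
    have h1 := hQ.convexDim_eq isCompact_simplexProduct convex_simplexProduct
    have h2 := hass.2.1
    rw [convexDim_simplexProduct] at h1
    rw [Set.mem_ofPred_eq]
    omega
  · rintro ⟨k, hk, rfl⟩
    rw [Set.mem_ofPred_eq] at hk
    obtain ⟨⟨Q, hQ⟩, hass⟩ := collisionTruncation (k := k) (n := n) (by omega)
    refine ⟨k, rfl, Q, ?_, hass Q hQ⟩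
    obtain ⟨L, -, -, -, hL⟩ := hQ
    exact hL.isIteratedTruncation

end Counting

theorem corollary7 (n : ℕ) (hn : 2 ≤ n) :
    (∀ k : Fin 3 → ℕ, (∑ r, k r) + 2 = n →
      (∃ Q, IsCollisionTruncation k Q) ∧
        ∀ Q, IsCollisionTruncation k Q → IsAssociahedron n Q) ∧
    (associahedronSources n).ncard =
      partitionsIntoParts 3 (n - 2) + partitionsIntoParts 2 (n - 2) + 1 := by
  refine ⟨fun k hk => collisionTruncation hk, ?_⟩
  rw [associahedronSources_eq hn, Set.ncard_image_eq_of_eq_iff (g := positiveParts)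
    (fun k _ k' _ => Quotient.eq.trans positiveParts_eq_iff.symm), image_positiveParts,
    Set.ncard_image_of_injective _ fun p q h => Nat.Partition.ext h, ncard_partitions_le_three]
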